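/- Let $a\ge 0$, $b>0$ and $c\in\mathbf R$. Let $V=V(y,t)$ be the bounded solution of $$V_t = V_{yy}-a^2(V-1)-2b\,\partial_y(1_{y>0})\,V\quad\text{in }\mathbf R\times(0,\infty),\qquad V(y,0)=1-ce^{-a|y|},$$ where $\partial_y(1_{y>0})=\delta$ is the Dirac measure at $y=0$. That is, $V$ is bounded and continuous on $\mathbf R\times[0,\infty)$, attains the initial data, and satisfies, for every $\varphi\in C_c^\infty(\mathbf R\times(0,\infty))$, $$-\int_0^\infty\!\!\int_{\mathbf R} V\varphi_t\,dy\,dt=\int_0^\infty\!\!\int_{\mathbf R}\bigl(V\varphi_{yy}-a^2(V-1)\varphi\bigr)\,dy\,dt-2b\int_0^\infty V(0,t)\varphi(0,t)\,dt .$$ For $\alpha\in\mathbf R$, $\beta>0$ and $t>0$ put $f^{\alpha}_{\beta}(t)=e^{-\alpha t}t^{\beta-1}/\Gamma(\beta)$, and set $$m_a(t)=2\Bigl\{f^{a^2}_{1/2}(t)+a^2\int_0^t f^{a^2}_{1/2}(s)\,ds-a\Bigr\},\qquad E^{0,b}_{\mathrm{sMM}}(\zeta)=b\zeta^2+a(\zeta-1)^2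 .$$ Then $\xi(t)=V(0,t)$ is differentiable on $(0,\infty)$, and for every $t>0$ the functions $s\mapsto\xi_s(s)$ and $s\mapsto m_a(t-s)\xi_s(s)$ are integrable on $(0,t)$ and $$\int_0^t m_a(t-s)\,\xi_s(s)\,ds=-\operatorname{grad}E^{0,b}_{\mathrm{sMM}}(\xi(t)).$$ Moreover, $m_a$ is differentiable on $(0,\infty)$ with $m_a'(t)<0$ and $m_a(t)>0$ for all $t>0$, and $\lim_{t\to\infty}m_a(t)=0$. -/

import Mathlib

open Set MeasureTheory Filter Topology
open scoped ContDiff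

namespace KWC

noncomputable section

/-- The single-well Modica--Mortola limit energy `E_sMM^{0,b}(ζ) = b ζ² + a (ζ - 1)²`. -/
def limitEnergy (a b ζ : ℝ) : ℝ := b * ζ ^ 2 + a * (ζ - 1) ^ 2

/-- `f_β^α(t) = e^{-α t} t^{β-1} / Γ(β)` (used for `t > 0`). -/
def fKernel (α β t : ℝ) : ℝ := Real.exp (-α * t) * t ^ (β - 1) / Real.Gamma β

/-- `m_a(t) = 2 { f_{1/2}^{a²}(t) + a² ∫₀ᵗ f_{1/2}^{a²}(s) ds - a }` (used for `t > 0`). -/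
def memoryKernel (a t : ℝ) : ℝ :=
  2 * (fKernel (a ^ 2) (1 / 2) t + a ^ 2 * (∫ s in (0 : ℝ)..t, fKernel (a ^ 2) (1 / 2) s) - a)

/-- Test functions `φ(y, t)` in `C_c^∞(ℝ × (0, ∞))`, extended by zero to `ℝ × ℝ`. -/
structure IsTestFunction (φ : ℝ × ℝ → ℝ) : Prop where
  smooth : ContDiff ℝ ∞ φ
  compactSupport : HasCompactSupport φ
  support_subset : tsupport φ ⊆ {p : ℝ × ℝ | 0 < p.2}

/-- `V = V(y, t)` is a bounded solution of
`τ₁ V_t = V_yy - a² (V - 1) - 2 b ∂_y(1_{y > 0}) V` in `ℝ × (0, ∞)` with initial data `V₀`: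
`V` is bounded and continuous on `ℝ × [0, ∞)`, `V(y, 0) = V₀(y)`, and the equation holds in the
sense of distributions on `ℝ × (0, ∞)`. As `V` is continuous and `∂_y(1_{y > 0})` is the Dirac
measure at `y = 0`, the last term paired with a test function `φ` is
`2 b ∫ V(0, t) φ(0, t) dt`. -/
structure IsBoundedSolution (τ₁ a b : ℝ) (V₀ : ℝ → ℝ) (V : ℝ → ℝ → ℝ) : Prop where
  continuousOn : ContinuousOn (fun p : ℝ × ℝ => V p.1 p.2) (univ ×ˢ Ici 0)
  bounded : ∃ M : ℝ, ∀ y t : ℝ, 0 ≤ t → |V y t| ≤ M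
  initial : ∀ y : ℝ, V y 0 = V₀ y
  equation : ∀ φ : ℝ × ℝ → ℝ, IsTestFunction φ →
    ∫ t in Ioi (0 : ℝ), ∫ y : ℝ, -(τ₁ * (V y t * deriv (fun s => φ (y, s)) t)) =
      (∫ t in Ioi (0 : ℝ), ∫ y : ℝ,
        (V y t * iteratedDeriv 2 (fun z => φ (z, t)) y - a ^ 2 * (V y t - 1) * φ (y, t)))
      - 2 * b * ∫ t in Ioi (0 : ℝ), V 0 t * φ (0, t)

end

end KWC

/-!
Everything is done with Laplace transforms in time, which turn the trace `ξ(t) = V(0, t)` into an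
explicit function. Write `μ = √(l + a²)`, `f = fKernel (a²) (1 / 2)`, whose transform is `1 / μ`,
and `A = a c - b (1 - c)`.

*The transform of the trace.* For `l > 0` the function `v = V̂(·, l)` solves
`μ² v - v'' + 2 b δ v = V₀ + a² / l` on the line. Testing with `e^{-μ |y|}`, for which
`μ² ψ - ψ'' = 2 μ δ`, leaves a closed equation for `v(0)`
(`IsBoundedSolution.laplace_trace`), so that no heat kernel and no uniqueness theorem for the
partial differential equation are needed. With the given initial data it says
`ξ̂ = (1 - c) / l + A / (l (μ + b))`. The test function `e^{-l t} e^{-μ |y|}` is not admissible as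
it stands: it is cut off in time (`laplace_of_weak_deriv`) and in space (`exists_testFunction_approx`)
and smoothed at `y = 0` (`smoothExpAbs`).

*The Abel equation.* There is an explicit function `h` (`traceDeriv`) with `ĥ = A / (μ + b)`, so
`ξ = (1 - c) + 1 * h` and `ξ' = h`. The memory kernel is `m_a = 2 (k - a)`, where
`k = f + a² (1 * f)` (`abelInverse`) has the transform `μ / l`. Hence `k * h` has the transform
`μ A / (l (μ + b)) = A / l - b A / (l (μ + b))`, that is `k * ξ' = A - b (ξ - (1 - c))`
(`trace_of_laplace_eq`), and subtracting `a (1 * ξ') = a (ξ - (1 - c))` gives the claim. These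
identities hold at every `t > 0`, not only almost everywhere, because all functions involved are
continuous on `(0, ∞)`; this and the integrability of the convolutions come from the class
`AbelType`.

*The kernel.* `m_a' = -f / t < 0`, and `m_a → 0` because `a² ∫₀^∞ f = a`; positivity follows.
-/

namespace KWC

/-! ### Functions with an inverse square root singularity at the origin -/

/-- Functions on `(0, ∞)` that are continuous and have at worst the singularity `t ^ (-1/2)` at the
origin. The class contains `fKernel α (1 / 2)` and all functions continuous on `[0, ∞)`, and it is
closed under linear combinations and convolution on the half line. Values at `t ≤ 0` are
irrelevant. -/
structure AbelType (p : ℝ → ℝ) : Prop where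
  continuousOn : ContinuousOn p (Ioi 0)
  bound : ∀ T : ℝ, ∃ C : ℝ, 0 ≤ C ∧ ∀ x, 0 < x → x ≤ T → |p x| ≤ C * (√x)⁻¹

/-- Convolution on the half line, `(p * q)(t) = ∫₀ᵗ p(s) q(t - s) ds`. -/
noncomputable def halfConv (p q : ℝ → ℝ) (t : ℝ) : ℝ := ∫ s in (0 : ℝ)..t, p s * q (t - s)

theorem AbelType.congr {p q : ℝ → ℝ} (hp : AbelType p) (h : EqOn q p (Ioi 0)) : AbelType q where
  continuousOn := hp.continuousOn.congr h
  bound T := by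
    obtain ⟨C, hC, hb⟩ := hp.bound T
    exact ⟨C, hC, fun x hx hxT => by rw [h hx]; exact hb x hx hxT⟩

theorem AbelType.add {p q : ℝ → ℝ} (hp : AbelType p) (hq : AbelType q) :
    AbelType (fun t => p t + q t) where
  continuousOn := hp.continuousOn.add hq.continuousOn
  bound T := by
    obtain ⟨C, hC, hb⟩ := hp.bound T
    obtain ⟨D, hD, hd⟩ := hq.bound T
    refine ⟨C + D, by positivity, fun x hx hxT => ?_⟩
    rw [add_mul]
    exact (abs_add_le _ _).trans (add_le_add (hb x hx hxT) (hd x hx hxT))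

theorem AbelType.const_mul {p : ℝ → ℝ} (hp : AbelType p) (k : ℝ) :
    AbelType (fun t => k * p t) where
  continuousOn := continuousOn_const.mul hp.continuousOn
  bound T := by
    obtain ⟨C, hC, hb⟩ := hp.bound T
    refine ⟨|k| * C, by positivity, fun x hx hxT => ?_⟩
    rw [abs_mul, mul_assoc]
    exact mul_le_mul_of_nonneg_left (hb x hx hxT) (abs_nonneg k)

theorem AbelType.sub {p q : ℝ → ℝ} (hp : AbelType p) (hq : AbelType q) :
    AbelType (fun t => p t - q t) :=
  (hp.add (hq.const_mul (-1))).congr fun t _ => by ring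

theorem AbelType.of_continuousOn {p : ℝ → ℝ} (hp : ContinuousOn p (Ici 0)) : AbelType p where
  continuousOn := hp.mono Ioi_subset_Ici_self
  bound T := by
    obtain ⟨C, hC⟩ := isCompact_Icc.exists_bound_of_continuousOn 
      (hp.mono (fun x hx => hx.1 : Icc 0 T ⊆ Ici 0))
    refine ⟨|C| * √T, by positivity, fun x hx hxT => ?_⟩
    have h1 : |p x| ≤ |C| := (hC x ⟨hx.le, hxT⟩).trans (le_abs_self C)
    have h2 : 1 ≤ √T * (√x)⁻¹ := by
      rw [← div_eq_mul_inv, one_le_div (Real.sqrt_pos.2 hx)]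
      exact Real.sqrt_le_sqrt hxT
    rw [mul_assoc]
    nlinarith [abs_nonneg C]

theorem intervalIntegrable_inv_sqrt (x y : ℝ) :
    IntervalIntegrable (fun s : ℝ => (√s)⁻¹) volume x y := by
  have h : ∀ T : ℝ, IntervalIntegrable (fun s : ℝ => (√s)⁻¹) volume 0 T := by
    intro T
    rcases le_total 0 T with hT | hT
    · refine (intervalIntegral.intervalIntegrable_rpow' (r := -(1 / 2)) (by norm_num)).congr ?_
      intro s hs
      rw [uIoc_of_le hT] at hs
      simp only [Real.sqrt_eq_rpow, Real.rpow_neg hs.1.le]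
    · refine (IntervalIntegrable.zero : IntervalIntegrable (0 : ℝ → ℝ) volume 0 T).congr ?_
      intro s hs
      rw [uIoc_of_ge hT] at hs
      simp [Real.sqrt_eq_zero_of_nonpos hs.2]
  exact (h x).symm.trans (h y)

theorem intervalIntegrable_of_continuousOn_Ioo {f g : ℝ → ℝ} {T : ℝ} (hT : 0 ≤ T)
    (hf : ContinuousOn f (Ioo 0 T)) (hg : IntervalIntegrable g volume 0 T)
    (h : ∀ s ∈ Ioo 0 T, |f s| ≤ g s) : IntervalIntegrable f volume 0 T := by
  refine hg.mono_fun' ?_ ?_ <;> rw [uIoc_of_le hT, ← restrict_Ioo_eq_restrict_Ioc]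
  · exact hf.aestronglyMeasurable measurableSet_Ioo
  · exact (ae_restrict_iff' measurableSet_Ioo).2 (ae_of_all _ h)

theorem AbelType.intervalIntegrable {p : ℝ → ℝ} (hp : AbelType p) {T : ℝ} (hT : 0 ≤ T) :
    IntervalIntegrable p volume 0 T := by
  obtain ⟨C, hC, hb⟩ := hp.bound T
  exact intervalIntegrable_of_continuousOn_Ioo hT (hp.continuousOn.mono fun s hs => hs.1)
    ((intervalIntegrable_inv_sqrt 0 T).const_mul C) fun s hs => hb s hs.1 hs.2.le

theorem inv_sqrt_mul_inv_sqrt_le {x y : ℝ} (hx : 0 < x) (hy : 0 < y) :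
    (√x)⁻¹ * (√y)⁻¹ ≤ (√(x + y))⁻¹ * ((√x)⁻¹ + (√y)⁻¹) := by
  have h1 := Real.sqrt_pos.2 hx
  have h2 := Real.sqrt_pos.2 hy
  have h3 := Real.sqrt_pos.2 (add_pos hx hy)
  have h4 : √(x + y) ≤ √x + √y := by
    rw [Real.sqrt_le_left (by positivity)]
    nlinarith [Real.sq_sqrt hx.le, Real.sq_sqrt hy.le, mul_pos h1 h2]
  rw [inv_mul_eq_div (√(x + y)), le_div_iff₀ h3]
  calc (√x)⁻¹ * (√y)⁻¹ * √(x + y) ≤ (√x)⁻¹ * (√y)⁻¹ * (√x + √y) := by gcongr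
    _ = (√x)⁻¹ + (√y)⁻¹ := by field_simp; ring

theorem AbelType.halfConv_integrable {p q : ℝ → ℝ} (hp : AbelType p) (hq : AbelType q) {T : ℝ}
    (hT : 0 < T) : IntervalIntegrable (fun s => p s * q (T - s)) volume 0 T := by
  obtain ⟨C, hC, hb⟩ := hp.bound T
  obtain ⟨D, hD, hd⟩ := hq.bound T
  have hB : IntervalIntegrable (fun s : ℝ => C * D * ((√T)⁻¹ * ((√s)⁻¹ + (√(T - s))⁻¹)))
      volume 0 T := by
    refine (((intervalIntegrable_inv_sqrt 0 T).add ?_).const_mul _).const_mul _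
    simpa using ((intervalIntegrable_inv_sqrt 0 T).comp_sub_left T).symm
  refine intervalIntegrable_of_continuousOn_Ioo hT.le ?_ hB fun s hs => ?_
  · refine (hp.continuousOn.mono fun s hs => hs.1).mul (hq.continuousOn.comp (by fun_prop) ?_)
    exact fun s hs => sub_pos.2 hs.2
  · have hs' : 0 < T - s := sub_pos.2 hs.2
    have h1 := inv_sqrt_mul_inv_sqrt_le hs.1 hs'
    rw [add_sub_cancel] at h1
    rw [abs_mul]
    calc |p s| * |q (T - s)| ≤ (C * (√s)⁻¹) * (D * (√(T - s))⁻¹) :=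
          mul_le_mul (hb s hs.1 hs.2.le) (hd _ hs' (by linarith [hs.1])) (abs_nonneg _)
            (by positivity)
      _ = C * D * ((√s)⁻¹ * (√(T - s))⁻¹) := by ring
      _ ≤ _ := by gcongr

/-- The substitution `s = t r` moves the dependence on `t` from the limits of integration into the
integrand, where a bound uniform in `t` is available. -/
theorem halfConv_eq_integral_unit (p q : ℝ → ℝ) (t : ℝ) :
    halfConv p q t = ∫ r in (0 : ℝ)..1, t * (p (t * r) * q (t * (1 - r))) := by
  have := intervalIntegral.mul_integral_comp_mul_left (a := 0) (b := 1)
    (f := fun s => p s * q (t - s)) t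
  rw [mul_zero, mul_one] at this
  rw [halfConv, ← this, ← intervalIntegral.integral_const_mul]
  simp only [mul_sub, mul_one]

theorem AbelType.halfConv {p q : ℝ → ℝ} (hp : AbelType p) (hq : AbelType q) :
    AbelType (halfConv p q) := by
  have key : ∀ T : ℝ, ∃ K : ℝ, 0 ≤ K ∧ ∀ t, 0 < t → t ≤ T → ∀ r ∈ Ioo (0 : ℝ) 1,
      |t * (p (t * r) * q (t * (1 - r)))| ≤ K * ((√r)⁻¹ + (√(1 - r))⁻¹) := by
    intro T
    obtain ⟨C, hC, hb⟩ := hp.bound T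
    obtain ⟨D, hD, hd⟩ := hq.bound T
    refine ⟨C * D, by positivity, fun t ht htT r hr => ?_⟩
    have hr' : 0 < 1 - r := sub_pos.2 hr.2
    have h1 := inv_sqrt_mul_inv_sqrt_le hr.1 hr'
    rw [add_sub_cancel, Real.sqrt_one, inv_one, one_mul] at h1
    have e1 := hb (t * r) (mul_pos ht hr.1) (by nlinarith [hr.2])
    have e2 := hd (t * (1 - r)) (mul_pos ht hr') (by nlinarith [hr.1])
    have ht2 : √t * √t = t := Real.mul_self_sqrt ht.le
    have ht3 : 0 < √t := Real.sqrt_pos.2 ht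
    rw [Real.sqrt_mul ht.le] at e1 e2
    rw [abs_mul, abs_mul, abs_of_pos ht]
    calc t * (|p (t * r)| * |q (t * (1 - r))|)
        ≤ t * ((C * (√t * √r)⁻¹) * (D * (√t * √(1 - r))⁻¹)) := by gcongr
      _ = (t * (√t * √t)⁻¹) * (C * D * ((√r)⁻¹ * (√(1 - r))⁻¹)) := by
          rw [mul_inv, mul_inv, mul_inv]; ring
      _ = C * D * ((√r)⁻¹ * (√(1 - r))⁻¹) := by rw [ht2, mul_inv_cancel₀ ht.ne', one_mul]
      _ ≤ _ := by gcongr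
  have hB : ∀ K : ℝ, IntervalIntegrable (fun r : ℝ => K * ((√r)⁻¹ + (√(1 - r))⁻¹)) volume 0 1 := by
    intro K
    refine ((intervalIntegrable_inv_sqrt 0 1).add ?_).const_mul _
    simpa using ((intervalIntegrable_inv_sqrt 0 1).comp_sub_left 1).symm
  have hioo : ∀ P : ℝ → Prop, (∀ r ∈ Ioo (0 : ℝ) 1, P r) →
      ∀ᵐ r : ℝ, r ∈ uIoc (0 : ℝ) 1 → P r := by
    intro P hP
    filter_upwards [compl_mem_ae_iff.2 (measure_singleton (1 : ℝ))] with r hr1 hr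
    rw [uIoc_of_le zero_le_one] at hr
    exact hP r ⟨hr.1, lt_of_le_of_ne hr.2 hr1⟩
  have hmem : ∀ t : ℝ, 0 < t → ∀ r ∈ Ioo (0 : ℝ) 1, 0 < t * r ∧ 0 < t * (1 - r) :=
    fun t ht r hr => ⟨mul_pos ht hr.1, mul_pos ht (sub_pos.2 hr.2)⟩
  constructor
  · intro t (ht : 0 < t)
    refine ContinuousAt.continuousWithinAt ?_
    simp_rw [funext (halfConv_eq_integral_unit p q)]
    obtain ⟨K, hK, hk⟩ := key (t + 1)
    have hnear : ∀ᶠ x in 𝓝 t, 0 < x ∧ x ≤ t + 1 :=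
      (lt_mem_nhds ht).and (ge_mem_nhds (by linarith))
    refine intervalIntegral.continuousAt_of_dominated_interval
      (bound := fun r => K * ((√r)⁻¹ + (√(1 - r))⁻¹)) ?_ ?_ (hB K) ?_
    · filter_upwards [hnear] with x hx
      rw [uIoc_of_le zero_le_one, ← restrict_Ioo_eq_restrict_Ioc]
      refine ContinuousOn.aestronglyMeasurable ?_ measurableSet_Ioo
      exact continuousOn_const.mul ((hp.continuousOn.comp (by fun_prop)
        fun r hr => (hmem x hx.1 r hr).1).mul (hq.continuousOn.comp (by fun_prop)
        fun r hr => (hmem x hx.1 r hr).2))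
    · filter_upwards [hnear] with x hx
      exact hioo _ fun r hr => hk x hx.1 hx.2 r hr
    · refine hioo _ fun r hr => ?_
      have c1 : ContinuousAt p (t * r) :=
        hp.continuousOn.continuousAt (Ioi_mem_nhds (hmem t ht r hr).1)
      have c2 : ContinuousAt q (t * (1 - r)) :=
        hq.continuousOn.continuousAt (Ioi_mem_nhds (hmem t ht r hr).2)
      exact continuousAt_id.mul ((ContinuousAt.comp (f := fun x => x * r) c1 (by fun_prop)).mul
        (ContinuousAt.comp (f := fun x => x * (1 - r)) c2 (by fun_prop)))
  · intro T
    obtain ⟨K, hK, hk⟩ := key T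
    set I := ∫ r in (0 : ℝ)..1, K * ((√r)⁻¹ + (√(1 - r))⁻¹) with hI
    have hI0 : 0 ≤ I := intervalIntegral.integral_nonneg zero_le_one fun r _ => by positivity
    have hle : ∀ x, 0 < x → x ≤ T → |KWC.halfConv p q x| ≤ I := by
      intro x hx hxT
      rw [halfConv_eq_integral_unit, ← Real.norm_eq_abs]
      refine intervalIntegral.norm_integral_le_of_norm_le zero_le_one ?_ (hB K)
      simpa only [uIoc_of_le (zero_le_one (α := ℝ)), Real.norm_eq_abs] using 
        hioo _ fun r hr => hk x hx hxT r hr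
    refine ⟨I * √T, by positivity, fun x hx hxT => ?_⟩
    have h2 : 1 ≤ √T * (√x)⁻¹ := by
      rw [← div_eq_mul_inv, one_le_div (Real.sqrt_pos.2 hx)]
      exact Real.sqrt_le_sqrt hxT
    rw [mul_assoc]
    nlinarith [hle x hx hxT]

theorem abelType_const (k : ℝ) : AbelType (fun _ => k) := .of_continuousOn continuousOn_const

theorem abelType_exp (k : ℝ) : AbelType (fun t => Real.exp (k * t)) :=
  .of_continuousOn (by fun_prop)

theorem fKernel_half (α : ℝ) {t : ℝ} (ht : 0 < t) :
    fKernel α (1 / 2) t = Real.exp (-α * t) * (√t)⁻¹ / √Real.pi := by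
  rw [fKernel, Real.Gamma_one_half_eq, Real.sqrt_eq_rpow t, ← Real.rpow_neg ht.le]
  norm_num

theorem abelType_fKernel (α : ℝ) : AbelType (fKernel α (1 / 2)) := by
  suffices h : AbelType (fun t => Real.exp (-α * t) * (√t)⁻¹ / √Real.pi) from
    h.congr fun t ht => fKernel_half α ht
  constructor
  · intro t (ht : 0 < t)
    have := (Real.sqrt_pos.2 ht).ne'
    exact ContinuousAt.continuousWithinAt (by fun_prop (disch := assumption))
  · intro T
    refine ⟨Real.exp (|α| * |T|) / √Real.pi, by positivity, fun x hx hxT => ?_⟩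
    rw [abs_of_nonneg (by positivity), mul_div_right_comm]
    gcongr ?_ * _
    refine div_le_div_of_nonneg_right (Real.exp_le_exp.2 ?_) (by positivity)
    have h1 : -α * x ≤ |α| * x := mul_le_mul_of_nonneg_right (neg_le_abs α) hx.le
    have h2 : |α| * x ≤ |α| * |T| := by gcongr; exact hxT.trans (le_abs_self T)
    linarith

/-! ### The Laplace transform -/

/-- The Laplace transform `p̂(l) = ∫₀^∞ e^{-l t} p(t) dt`. -/
noncomputable def laplace (p : ℝ → ℝ) (l : ℝ) : ℝ := ∫ t in Ioi (0 : ℝ), Real.exp (-(l * t)) * p t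

/-- The integral defining `laplace p l` converges absolutely. -/
def LaplaceConv (p : ℝ → ℝ) (l : ℝ) : Prop :=
  IntegrableOn (fun t => Real.exp (-(l * t)) * p t) (Ioi 0)

theorem LaplaceConv.add {p q : ℝ → ℝ} {l : ℝ} (hp : LaplaceConv p l) (hq : LaplaceConv q l) :
    LaplaceConv (fun t => p t + q t) l := by
  simp only [LaplaceConv, mul_add]; exact Integrable.add hp hq

theorem LaplaceConv.const_mul {p : ℝ → ℝ} {l : ℝ} (hp : LaplaceConv p l) (k : ℝ) :
    LaplaceConv (fun t => k * p t) l := by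
  simp only [LaplaceConv, mul_left_comm _ k]; exact Integrable.const_mul hp k

theorem LaplaceConv.sub {p q : ℝ → ℝ} {l : ℝ} (hp : LaplaceConv p l) (hq : LaplaceConv q l) :
    LaplaceConv (fun t => p t - q t) l := by
  simp only [LaplaceConv, mul_sub]; exact Integrable.sub hp hq

theorem laplace_add {p q : ℝ → ℝ} {l : ℝ} (hp : LaplaceConv p l) (hq : LaplaceConv q l) :
    laplace (fun t => p t + q t) l = laplace p l + laplace q l := by
  simp only [laplace, mul_add]; exact integral_add hp hq

theorem laplace_sub {p q : ℝ → ℝ} {l : ℝ} (hp : LaplaceConv p l) (hq : LaplaceConv q l) :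
    laplace (fun t => p t - q t) l = laplace p l - laplace q l := by
  simp only [laplace, mul_sub]; exact integral_sub hp hq

theorem laplace_const_mul (p : ℝ → ℝ) (k l : ℝ) :
    laplace (fun t => k * p t) l = k * laplace p l := by
  simp only [laplace, mul_left_comm _ k]; exact integral_const_mul _ _

theorem exp_mul_halfConv (p q : ℝ → ℝ) (l t : ℝ) :
    Real.exp (-(l * t)) * halfConv p q t = ∫ s in (0 : ℝ)..t,
      (Real.exp (-(l * s)) * p s) * (Real.exp (-(l * (t - s))) * q (t - s)) := by
  rw [halfConv, ← intervalIntegral.integral_const_mul]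
  congr 1
  ext s
  rw [show -(l * t) = -(l * s) + -(l * (t - s)) by ring, Real.exp_add]
  ring

theorem LaplaceConv.halfConv {p q : ℝ → ℝ} {l : ℝ} (hp : LaplaceConv p l) (hq : LaplaceConv q l) :
    LaplaceConv (halfConv p q) l := by
  have := (integrable_posConvolution hp hq (ContinuousLinearMap.mul ℝ ℝ)).integrableOn (s := Ioi 0)
  refine this.congr_fun (fun t ht => ?_) measurableSet_Ioi
  simp only [posConvolution, indicator_of_mem ht, ContinuousLinearMap.mul_apply']
  exact (exp_mul_halfConv p q l t).symm

theorem laplace_halfConv {p q : ℝ → ℝ} {l : ℝ} (hp : LaplaceConv p l) (hq : LaplaceConv q l) :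
    laplace (halfConv p q) l = laplace p l * laplace q l := by
  have := integral_posConvolution hp hq (ContinuousLinearMap.mul ℝ ℝ)
  simp only [ContinuousLinearMap.mul_apply', ← exp_mul_halfConv] at this
  exact this

theorem laplaceConv_exp {k l : ℝ} (h : k < l) : LaplaceConv (fun t => Real.exp (k * t)) l := by
  refine (integrableOn_exp_mul_Ioi (a := k - l) (by linarith) 0).congr_fun (fun t _ => ?_)
    measurableSet_Ioi
  simp only [← Real.exp_add]
  congr 1; ring

theorem laplace_exp {k l : ℝ} (h : k < l) :
    laplace (fun t => Real.exp (k * t)) l = 1 / (l - k) := by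
  have := integral_exp_mul_Ioi (a := k - l) (by linarith) 0
  rw [mul_zero, Real.exp_zero, ← neg_sub l k, neg_div_neg_eq] at this
  rw [laplace, ← this]
  congr 1 with t
  rw [← Real.exp_add]
  congr 1; ring

theorem laplaceConv_const {l : ℝ} (h : 0 < l) (k : ℝ) : LaplaceConv (fun _ => k) l := by
  simpa using (laplaceConv_exp h).const_mul k

theorem laplace_const {l : ℝ} (h : 0 < l) (k : ℝ) : laplace (fun _ => k) l = k / l := by
  have := laplace_const_mul (fun t => Real.exp (0 * t)) k l
  rw [laplace_exp h] at this
  simpa [div_eq_mul_inv] using this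

theorem laplace_fKernel {α l : ℝ} (h : 0 < l + α) :
    laplace (fKernel α (1 / 2)) l = 1 / √(l + α) := by
  have h1 := Real.integral_rpow_mul_exp_neg_mul_Ioi (a := 1 / 2) (r := l + α) (by norm_num) h
  rw [← Real.sqrt_eq_rpow, Real.sqrt_div' _ h.le, Real.sqrt_one] at h1
  have h2 : Real.Gamma (1 / 2) ≠ 0 := (Real.Gamma_pos_of_pos (by norm_num)).ne'
  rw [laplace, ← mul_div_cancel_right₀ (1 / √(l + α)) h2, ← h1, ← integral_div]
  congr 1 with t
  rw [fKernel, show -((l + α) * t) = -(l * t) + -α * t by ring, Real.exp_add]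
  ring

theorem laplaceConv_fKernel {α l : ℝ} (h : 0 < l + α) : LaplaceConv (fKernel α (1 / 2)) l := by
  by_contra hn
  have := laplace_fKernel h
  rw [laplace, integral_undef hn] at this
  exact (one_div_pos.2 (Real.sqrt_pos.2 h)).ne this

/-- The Laplace transform determines a function. With `x = e^{-t}` the transform at `l₀ + 1 + n`
is the `n`-th moment on `[0, 1]`, so all continuous functions of `e^{-t}` integrate to zero by
Weierstrass' theorem, in particular all test functions with compact support in `(0, ∞)`. -/
theorem eqOn_zero_of_laplace_eq_zero {p : ℝ → ℝ} (hp : ContinuousOn p (Ioi 0)) {l₀ : ℝ}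
    (hl : ∀ l, l₀ < l → LaplaceConv p l) (h0 : ∀ l, l₀ < l → laplace p l = 0) :
    EqOn p 0 (Ioi 0) := by
  set q : ℝ → ℝ := fun t => Real.exp (-((l₀ + 1) * t)) * p t with hq
  have hqi : IntegrableOn q (Ioi 0) := hl (l₀ + 1) (by linarith)
  have hmon : ∀ (n : ℕ), IntegrableOn (fun t => Real.exp (-t) ^ n * q t) (Ioi 0) ∧
      ∫ t in Ioi (0 : ℝ), Real.exp (-t) ^ n * q t = 0 := by
    intro n
    have hn : l₀ < l₀ + 1 + n := by have : (0 : ℝ) ≤ n := n.cast_nonneg; linarith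
    have e : (fun t => Real.exp (-t) ^ n * q t) =
        fun t => Real.exp (-((l₀ + 1 + n) * t)) * p t := by
      ext t
      rw [hq, ← Real.exp_nat_mul, ← mul_assoc, ← Real.exp_add]
      congr 2; ring
    rw [e]
    exact ⟨hl _ hn, h0 _ hn⟩
  have hpoly : ∀ P : Polynomial ℝ, IntegrableOn (fun t => P.eval (Real.exp (-t)) * q t) (Ioi 0) ∧
      ∫ t in Ioi (0 : ℝ), P.eval (Real.exp (-t)) * q t = 0 := by
    intro P
    simp only [Polynomial.eval_eq_sum_range, Finset.sum_mul, mul_assoc]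
    have hi : ∀ i ∈ Finset.range (P.natDegree + 1),
        IntegrableOn (fun t => P.coeff i * (Real.exp (-t) ^ i * q t)) (Ioi 0) :=
      fun i _ => Integrable.const_mul (hmon i).1 _
    refine ⟨integrable_finsetSum _ hi, ?_⟩
    rw [integral_finsetSum _ hi]
    exact Finset.sum_eq_zero fun i _ => by rw [integral_const_mul, (hmon i).2, mul_zero]
  have htest : ∀ g : ℝ → ℝ, ContDiff ℝ ∞ g → HasCompactSupport g → tsupport g ⊆ Ioi 0 →
      ∫ t, g t • (Ioi (0 : ℝ)).indicator q t = 0 := by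
    intro g hg hgc hgs
    have hg0 : g 0 = 0 := image_eq_zero_of_notMem_tsupport fun h => lt_irrefl (0 : ℝ) (hgs h)
    have hG : ContinuousOn (fun x => g (-Real.log x)) (Icc 0 1) := by
      refine Continuous.continuousOn (continuous_iff_continuousAt.2 fun x => ?_)
      rcases eq_or_ne x 0 with rfl | hx
      · have hlim : Tendsto (fun x => g (-Real.log x)) (𝓝[≠] 0) (𝓝 0) := by
          have h1 : ∀ᶠ y in atTop, g y = 0 := by
            obtain ⟨R, hR⟩ := hgc.isCompact.bddAbove
            filter_upwards [eventually_gt_atTop R] with y hy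
            exact image_eq_zero_of_notMem_tsupport fun h => absurd (hR h) (not_le.2 hy)
          have h2 : Tendsto (fun x => -Real.log x) (𝓝[≠] 0) atTop :=
            tendsto_neg_atBot_atTop.comp Real.tendsto_log_nhdsNE_zero
          exact tendsto_const_nhds.congr' ((h2.eventually h1).mono fun x hx => hx.symm)
        rw [continuousAt_iff_punctured_nhds]
        simpa [hg0] using hlim
      · exact ContinuousAt.comp (f := fun x => -Real.log x) hg.continuous.continuousAt
          (Real.continuousAt_log hx).neg
    have e : ∫ t, g t • (Ioi (0 : ℝ)).indicator q t = ∫ t in Ioi (0 : ℝ), g t * q t := by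
      rw [← integral_indicator measurableSet_Ioi]
      congr 1 with t
      by_cases ht : t ∈ Ioi (0 : ℝ) <;> simp [ht]
    rw [e]
    have hgb : IntegrableOn (fun t => g t * q t) (Ioi 0) := by
      obtain ⟨C, hC⟩ := hgc.exists_bound_of_continuous hg.continuous
      exact Integrable.bdd_mul hqi hg.continuous.aestronglyMeasurable (ae_of_all _ hC)
    set N := ∫ t in Ioi (0 : ℝ), |q t| with hN
    have hN0 : 0 ≤ N := integral_nonneg fun t => abs_nonneg _
    refine abs_eq_zero.1 (le_antisymm (le_of_forall_pos_le_add fun ε hε => ?_) (abs_nonneg _))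
    obtain ⟨P, hP⟩ := exists_polynomial_near_of_continuousOn 0 1 _ hG (ε / (N + 1)) (by positivity)
    have e2 : ∫ t in Ioi (0 : ℝ), g t * q t =
        ∫ t in Ioi (0 : ℝ), (g t * q t - P.eval (Real.exp (-t)) * q t) := by
      rw [integral_sub hgb (hpoly P).1, (hpoly P).2, sub_zero]
    rw [e2, zero_add, ← Real.norm_eq_abs]
    have e3 : ∀ t ∈ Ioi (0 : ℝ), ‖g t * q t - P.eval (Real.exp (-t)) * q t‖
        ≤ ε / (N + 1) * |q t| := by
      intro t (ht : 0 < t)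
      have h3 := hP (Real.exp (-t)) ⟨(Real.exp_pos _).le, Real.exp_le_one_iff.2 (by linarith)⟩
      rw [Real.log_exp, neg_neg, abs_sub_comm] at h3
      rw [← sub_mul, Real.norm_eq_abs, abs_mul]
      exact mul_le_mul_of_nonneg_right h3.le (abs_nonneg _)
    calc _ ≤ ∫ t in Ioi (0 : ℝ), ε / (N + 1) * |q t| :=
          norm_integral_le_of_norm_le (Integrable.const_mul (Integrable.abs hqi) _)
            ((ae_restrict_iff' measurableSet_Ioi).2 (ae_of_all _ e3))
      _ = ε * (N / (N + 1)) := by rw [integral_const_mul, ← hN]; ring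
      _ ≤ ε * 1 := by
          gcongr
          rw [div_le_one (by positivity)]; linarith
      _ = ε := mul_one ε
  have hae := isOpen_Ioi.ae_eq_zero_of_integral_contDiff_smul_eq_zero
    (((integrable_indicator_iff measurableSet_Ioi).2 hqi).locallyIntegrable.locallyIntegrableOn _)
    htest
  have hae' : p =ᵐ[volume.restrict (Ioi 0)] 0 := by
    refine (ae_restrict_iff' measurableSet_Ioi).2 ?_
    filter_upwards [hae] with t h ht
    have := h ht
    rw [indicator_of_mem ht, hq, mul_eq_zero] at this
    exact this.resolve_left (Real.exp_ne_zero _)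
  exact Measure.eqOn_open_of_ae_eq hae' isOpen_Ioi hp continuousOn_const

theorem eqOn_of_laplace_eq {p q : ℝ → ℝ} (hp : ContinuousOn p (Ioi 0)) (hq : ContinuousOn q (Ioi 0))
    {l₀ : ℝ} (hpl : ∀ l, l₀ < l → LaplaceConv p l) (hql : ∀ l, l₀ < l → LaplaceConv q l)
    (h : ∀ l, l₀ < l → laplace p l = laplace q l) : EqOn p q (Ioi 0) := fun t ht =>
  sub_eq_zero.1 (eqOn_zero_of_laplace_eq_zero (hp.sub hq) (fun l hl => (hpl l hl).sub (hql l hl))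
    (fun l hl => by
      have := laplace_sub (hpl l hl) (hql l hl)
      rwa [h l hl, sub_self] at this) ht)

/-! ### The memory kernel -/

theorem hasDerivAt_fKernel_half (α : ℝ) {t : ℝ} (ht : 0 < t) :
    HasDerivAt (fKernel α (1 / 2)) (-(α + 1 / (2 * t)) * fKernel α (1 / 2) t) t := by
  have h1 : HasDerivAt (fun t : ℝ => Real.exp (-α * t)) (Real.exp (-α * t) * (-α * 1)) t :=
    ((hasDerivAt_id t).const_mul (-α)).exp
  have h2 := Real.hasDerivAt_rpow_const (x := t) (p := 1 / 2 - 1) (Or.inl ht.ne')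
  refine ((h1.mul h2).div_const _).congr_deriv ?_
  rw [Real.rpow_sub_one ht.ne' (1 / 2 - 1), fKernel]
  field_simp
  ring

/-- The inverse of convolution with `f = fKernel (a²) (1 / 2)`: `abelInverse a = f + a² (1 * f)`
satisfies `abelInverse a * f = 1`, which in Laplace transforms reads
`(√(l + a²) / l) (1 / √(l + a²)) = 1 / l`. -/
noncomputable def abelInverse (a t : ℝ) : ℝ :=
  fKernel (a ^ 2) (1 / 2) t + a ^ 2 * halfConv (fKernel (a ^ 2) (1 / 2)) (fun _ => 1) t

theorem memoryKernel_eq (a t : ℝ) : memoryKernel a t = 2 * (abelInverse a t - a) := by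
  simp only [memoryKernel, abelInverse, halfConv, mul_one]

theorem abelType_abelInverse (a : ℝ) : AbelType (abelInverse a) :=
  (abelType_fKernel _).add (((abelType_fKernel _).halfConv (abelType_const 1)).const_mul _)

theorem laplaceConv_abelInverse (a : ℝ) {l : ℝ} (hl : 0 < l) : LaplaceConv (abelInverse a) l :=
  have h := laplaceConv_fKernel (α := a ^ 2) (l := l) (by positivity)
  h.add ((h.halfConv (laplaceConv_const hl 1)).const_mul _)

theorem laplace_abelInverse (a : ℝ) {l : ℝ} (hl : 0 < l) :
    laplace (abelInverse a) l = √(l + a ^ 2) / l := by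
  have hp : 0 < l + a ^ 2 := by positivity
  have h := laplaceConv_fKernel hp
  have h1 := laplaceConv_const hl 1
  have hs := Real.sqrt_pos.2 hp
  have hsq := Real.sq_sqrt hp.le
  refine (laplace_add h ((h.halfConv h1).const_mul (a ^ 2))).trans ?_
  rw [laplace_const_mul, laplace_halfConv h h1, laplace_fKernel hp, laplace_const hl]
  field_simp
  linarith

theorem hasDerivAt_halfConv_one {p : ℝ → ℝ} (hp : AbelType p) {t : ℝ} (ht : 0 < t) :
    HasDerivAt (halfConv p fun _ => 1) (p t) t := by
  have := intervalIntegral.integral_hasDerivAt_right (hp.intervalIntegrable ht.le)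
    (hp.continuousOn.stronglyMeasurableAtFilter isOpen_Ioi t ht)
    (hp.continuousOn.continuousAt (Ioi_mem_nhds ht))
  simpa only [funext fun t => (show halfConv p (fun _ => 1) t = ∫ s in (0 : ℝ)..t, p s by
    simp only [halfConv, mul_one])] using this

theorem fKernel_half_pos (α : ℝ) {t : ℝ} (ht : 0 < t) : 0 < fKernel α (1 / 2) t :=
  div_pos (mul_pos (Real.exp_pos _) (Real.rpow_pos_of_pos ht _))
    (Real.Gamma_pos_of_pos (by norm_num))

theorem hasDerivAt_memoryKernel (a : ℝ) {t : ℝ} (ht : 0 < t) :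
    HasDerivAt (memoryKernel a) (-(fKernel (a ^ 2) (1 / 2) t / t)) t := by
  have := (((hasDerivAt_fKernel_half (a ^ 2) ht).add
    ((hasDerivAt_halfConv_one (abelType_fKernel (a ^ 2)) ht).const_mul (a ^ 2))).sub_const
    a).const_mul 2
  rw [funext (memoryKernel_eq a)]
  refine this.congr_deriv ?_
  field_simp
  ring

theorem deriv_memoryKernel_neg (a : ℝ) {t : ℝ} (ht : 0 < t) : deriv (memoryKernel a) t < 0 := by
  rw [(hasDerivAt_memoryKernel a ht).deriv]
  exact neg_neg_of_pos (div_pos (fKernel_half_pos _ ht) ht)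

theorem tendsto_fKernel_half {α : ℝ} (hα : 0 ≤ α) :
    Tendsto (fKernel α (1 / 2)) atTop (𝓝 0) := by
  have h1 : Tendsto (fun t : ℝ => (√t)⁻¹ / √Real.pi) atTop (𝓝 0) := by
    simpa using (tendsto_inv_atTop_zero.comp Real.tendsto_sqrt_atTop).div_const (√Real.pi)
  refine tendsto_of_tendsto_of_tendsto_of_le_of_le' tendsto_const_nhds h1 ?_ ?_
  · filter_upwards [eventually_gt_atTop 0] with t ht using (fKernel_half_pos α ht).le
  · filter_upwards [eventually_gt_atTop 0] with t ht
    rw [fKernel_half α ht]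
    have : Real.exp (-α * t) ≤ 1 := Real.exp_le_one_iff.2 (by nlinarith)
    gcongr
    exact mul_le_of_le_one_left (by positivity) this

/-- The constant subtracted in `memoryKernel` is the limit of `abelInverse a`, because
`∫₀^∞ fKernel (a²) (1 / 2) = 1 / a` for `a > 0`. -/
theorem tendsto_memoryKernel {a : ℝ} (ha : 0 ≤ a) : Tendsto (memoryKernel a) atTop (𝓝 0) := by
  have h1 := tendsto_fKernel_half (sq_nonneg a)
  suffices h2 : Tendsto (fun t => a ^ 2 * ∫ s in (0 : ℝ)..t, fKernel (a ^ 2) (1 / 2) s) atTop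
      (𝓝 a) by
    have h3 := ((h1.add h2).sub_const a).const_mul 2
    rwa [zero_add, sub_self, mul_zero] at h3
  rcases ha.eq_or_lt with rfl | ha
  · simp
  have hp : 0 < 0 + a ^ 2 := by positivity
  have h3 := laplaceConv_fKernel hp
  have h4 := laplace_fKernel hp
  simp only [LaplaceConv, laplace, zero_mul, neg_zero, Real.exp_zero, one_mul, zero_add,
    Real.sqrt_sq ha.le] at h3 h4
  have h5 := (intervalIntegral_tendsto_integral_Ioi 0 h3 tendsto_id).const_mul (a ^ 2)
  rw [h4] at h5
  rwa [pow_two, mul_assoc, mul_one_div_cancel ha.ne', mul_one, ← pow_two] at h5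

theorem memoryKernel_pos {a : ℝ} (ha : 0 ≤ a) {t : ℝ} (ht : 0 < t) : 0 < memoryKernel a t := by
  have hanti : StrictAntiOn (memoryKernel a) (Ioi 0) := by
    refine strictAntiOn_of_deriv_neg (convex_Ioi 0)
      (fun s hs => (hasDerivAt_memoryKernel a hs).continuousAt.continuousWithinAt) fun s hs => ?_
    rw [interior_Ioi] at hs
    exact deriv_memoryKernel_neg a hs
  have ht1 : (0 : ℝ) < t + 1 := by linarith
  refine lt_of_le_of_lt ?_ (hanti ht ht1 (by linarith))
  refine le_of_tendsto (tendsto_memoryKernel ha) ?_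
  filter_upwards [eventually_ge_atTop (t + 1)] with s hs
  exact hanti.antitoneOn ht1 (ht1.trans_le hs) hs

/-! ### Recovering the trace from its Laplace transform -/

/-- The function with Laplace transform `A / (√(l + a²) + b)`, which turns out to be the derivative
of the trace. Its form comes from
`1 / (μ + b) = (1 / μ - b / μ²) (1 + b² / (μ² - b²))` with `μ² = l + a²`. -/
noncomputable def traceDeriv (a b A t : ℝ) : ℝ :=
  A * ((fKernel (a ^ 2) (1 / 2) t - b * Real.exp (-a ^ 2 * t)) + b ^ 2 *
    halfConv (fun s => fKernel (a ^ 2) (1 / 2) s - b * Real.exp (-a ^ 2 * s))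
      (fun s => Real.exp ((b ^ 2 - a ^ 2) * s)) t)

theorem abelType_traceDeriv (a b A : ℝ) : AbelType (traceDeriv a b A) :=
  have h := (abelType_fKernel (a ^ 2)).sub ((abelType_exp (-a ^ 2)).const_mul b)
  (h.add ((h.halfConv (abelType_exp _)).const_mul (b ^ 2))).const_mul A

theorem laplaceConv_traceDeriv (a b A : ℝ) {l : ℝ} (hl : b ^ 2 < l) :
    LaplaceConv (traceDeriv a b A) l := by
  have hl0 : 0 < l := (sq_nonneg b).trans_lt hl
  have h := (laplaceConv_fKernel (α := a ^ 2) (l := l) (by positivity)).sub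
    ((laplaceConv_exp (k := -a ^ 2) (l := l) (by nlinarith [sq_nonneg a])).const_mul b)
  have h2 := laplaceConv_exp (k := b ^ 2 - a ^ 2) (l := l) (by nlinarith [sq_nonneg a])
  exact (h.add ((h.halfConv h2).const_mul (b ^ 2))).const_mul A

theorem laplace_traceDeriv (a A : ℝ) {b l : ℝ} (hb : 0 < b) (hl : b ^ 2 < l) :
    laplace (traceDeriv a b A) l = A / (√(l + a ^ 2) + b) := by
  have hl0 : 0 < l := (sq_nonneg b).trans_lt hl
  have hp : 0 < l + a ^ 2 := by positivity
  have hs := Real.sqrt_pos.2 hp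
  have hsq := Real.sq_sqrt hp.le
  have hf := laplaceConv_fKernel hp
  have he := laplaceConv_exp (k := -a ^ 2) (l := l) (by nlinarith [sq_nonneg a])
  have h := hf.sub (he.const_mul b)
  have h2 := laplaceConv_exp (k := b ^ 2 - a ^ 2) (l := l) (by nlinarith [sq_nonneg a])
  have e1 : l - -a ^ 2 = √(l + a ^ 2) ^ 2 := by rw [hsq]; ring
  have e2 : l - (b ^ 2 - a ^ 2) = (√(l + a ^ 2) + b) * (√(l + a ^ 2) - b) := by
    rw [← sq_sub_sq, hsq]; ring
  have hne : √(l + a ^ 2) - b ≠ 0 := fun h0 => by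
    rw [h0, mul_zero] at e2
    nlinarith [sq_nonneg a]
  have e3 : laplace (fun s => fKernel (a ^ 2) (1 / 2) s - b * Real.exp (-a ^ 2 * s)) l =
      1 / √(l + a ^ 2) - b * (1 / √(l + a ^ 2) ^ 2) := by
    rw [laplace_sub hf (he.const_mul b), laplace_const_mul, laplace_fKernel hp,
      laplace_exp (by nlinarith [sq_nonneg a]), e1]
  refine (laplace_const_mul _ A l).trans ?_
  rw [laplace_add h ((h.halfConv h2).const_mul _), laplace_const_mul, laplace_halfConv h h2, e3,
    laplace_exp (by nlinarith [sq_nonneg a]), e2]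
  have := (add_pos hs hb).ne'
  field_simp
  ring

/-- A continuous function with this Laplace transform is `ξ₀ + ∫₀ᵗ traceDeriv`, and its derivative
solves the Abel equation `abelInverse a * ξ' = A - b (ξ - ξ₀)`. -/
theorem trace_of_laplace_eq {a b A ξ₀ : ℝ} (hb : 0 < b) {ξ : ℝ → ℝ} (hξ : ContinuousOn ξ (Ioi 0))
    (hconv : ∀ l, 0 < l → LaplaceConv ξ l)
    (hl : ∀ l, 0 < l → laplace ξ l = ξ₀ / l + A / (l * (√(l + a ^ 2) + b))) {t : ℝ} (ht : 0 < t) :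
    HasDerivAt ξ (traceDeriv a b A t) t ∧
    halfConv (traceDeriv a b A) (fun _ => 1) t = ξ t - ξ₀ ∧
    halfConv (traceDeriv a b A) (abelInverse a) t = A - b * (ξ t - ξ₀) := by
  have hA := abelType_traceDeriv a b A
  have hpos : ∀ l, b ^ 2 < l → 0 < l := fun l h => (sq_nonneg b).trans_lt h
  have hAi : ∀ l, b ^ 2 < l → LaplaceConv (halfConv (traceDeriv a b A) fun _ => 1) l := fun l h =>
    (laplaceConv_traceDeriv a b A h).halfConv (laplaceConv_const (hpos l h) 1)
  have hlA : ∀ l, b ^ 2 < l → laplace (halfConv (traceDeriv a b A) fun _ => 1) l =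
      A / (√(l + a ^ 2) + b) * (1 / l) := fun l h => by
    rw [laplace_halfConv (laplaceConv_traceDeriv a b A h) (laplaceConv_const (hpos l h) 1),
      laplace_traceDeriv a A hb h, laplace_const (hpos l h)]
  have heq : EqOn ξ (fun t => ξ₀ + halfConv (traceDeriv a b A) (fun _ => 1) t) (Ioi 0) := by
    refine eqOn_of_laplace_eq hξ
      (continuousOn_const.add (hA.halfConv (abelType_const 1)).continuousOn) (l₀ := b ^ 2)
      (fun l h => hconv l (hpos l h)) (fun l h => (laplaceConv_const (hpos l h) ξ₀).add (hAi l h))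
      fun l h => ?_
    rw [laplace_add (laplaceConv_const (hpos l h) ξ₀) (hAi l h), hlA l h, hl l (hpos l h),
      laplace_const (hpos l h), div_mul_div_comm, mul_one, mul_comm l]
  have heq2 : EqOn (halfConv (traceDeriv a b A) (abelInverse a))
      (fun t => A - b * halfConv (traceDeriv a b A) (fun _ => 1) t) (Ioi 0) := by
    refine eqOn_of_laplace_eq (hA.halfConv (abelType_abelInverse a)).continuousOn
      (continuousOn_const.sub (continuousOn_const.mul
        (hA.halfConv (abelType_const 1)).continuousOn)) (l₀ := b ^ 2)
      (fun l h => (laplaceConv_traceDeriv a b A h).halfConv (laplaceConv_abelInverse a (hpos l h)))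
      (fun l h => (laplaceConv_const (hpos l h) A).sub ((hAi l h).const_mul b)) fun l h => ?_
    rw [laplace_halfConv (laplaceConv_traceDeriv a b A h) (laplaceConv_abelInverse a (hpos l h)),
      laplace_traceDeriv a A hb h, laplace_abelInverse a (hpos l h),
      laplace_sub (laplaceConv_const (hpos l h) A) ((hAi l h).const_mul b), laplace_const_mul,
      hlA l h, laplace_const (hpos l h)]
    have h1 := hpos l h
    have h2 : √(l + a ^ 2) + b ≠ 0 := by positivity
    field_simp
    ring
  have h1 : halfConv (traceDeriv a b A) (fun _ => 1) t = ξ t - ξ₀ := by rw [heq ht]; ring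
  refine ⟨?_, h1, (heq2 ht).trans (by simp only [h1])⟩
  exact ((hasDerivAt_halfConv_one hA ht).const_add ξ₀).congr_of_eventuallyEq
    (heq.eventuallyEq_of_mem (Ioi_mem_nhds ht))

/-! ### Weak derivatives in time and the Laplace transform -/

theorem integrableOn_exp_neg_mul {l : ℝ} (hl : 0 < l) :
    IntegrableOn (fun t => Real.exp (-(l * t))) (Ioi 0) := by
  simpa [LaplaceConv] using laplaceConv_const hl 1

theorem LaplaceConv.of_bounded {p : ℝ → ℝ} (hp : Continuous p) {M : ℝ} (hM : ∀ t, |p t| ≤ M)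
    {l : ℝ} (hl : 0 < l) : LaplaceConv p l :=
  Integrable.mul_bdd (integrableOn_exp_neg_mul hl) hp.aestronglyMeasurable
    (ae_of_all _ hM)

theorem deriv_smoothTransition_eq_zero {x : ℝ} (hx : x < 0 ∨ 1 < x) :
    deriv Real.smoothTransition x = 0 := by
  rcases hx with hx | hx
  · have : Real.smoothTransition =ᶠ[𝓝 x] fun _ => 0 := by
      filter_upwards [gt_mem_nhds hx] with y hy using Real.smoothTransition.zero_of_nonpos hy.le
    rw [this.deriv_eq, deriv_const]
  · have : Real.smoothTransition =ᶠ[𝓝 x] fun _ => 1 := by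
      filter_upwards [lt_mem_nhds hx] with y hy using Real.smoothTransition.one_of_one_le hy.le
    rw [this.deriv_eq, deriv_const]

theorem continuous_deriv_smoothTransition : Continuous (deriv Real.smoothTransition) :=
  (Real.smoothTransition.contDiff (n := 1)).continuous_deriv (by norm_num)

theorem hasCompactSupport_deriv_smoothTransition :
    HasCompactSupport (deriv Real.smoothTransition) :=
  .intro (isCompact_Icc (a := 0) (b := 1)) fun x hx =>
    deriv_smoothTransition_eq_zero (by
      by_contra! h
      exact hx h)

theorem hasDerivAt_smoothTransition (x : ℝ) :
    HasDerivAt Real.smoothTransition (deriv Real.smoothTransition x) x :=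
  ((Real.smoothTransition.contDiff (n := 1)).differentiable (by norm_num) x).hasDerivAt

theorem integral_deriv_smoothTransition :
    ∫ s in Ioi (0 : ℝ), deriv Real.smoothTransition (s - 1) = 1 := by
  have hd : ∀ x ∈ Ici (0 : ℝ), HasDerivAt (fun s => Real.smoothTransition (s - 1))
      (deriv Real.smoothTransition (x - 1)) x := fun x _ => by
    exact ((hasDerivAt_smoothTransition (x - 1)).comp x ((hasDerivAt_id x).sub_const 1)).congr_deriv
      (mul_one _)
  have hi : Integrable (fun s : ℝ => deriv Real.smoothTransition (s - 1)) :=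
    (continuous_deriv_smoothTransition.integrable_of_hasCompactSupport
      hasCompactSupport_deriv_smoothTransition).comp_sub_right 1
  have hlim : Tendsto (fun s : ℝ => Real.smoothTransition (s - 1)) atTop (𝓝 1) := by
    refine tendsto_const_nhds.congr' ?_
    filter_upwards [eventually_ge_atTop 2] with s hs
    exact (Real.smoothTransition.one_of_one_le (by linarith)).symm
  rw [integral_Ioi_of_hasDerivAt_of_tendsto' hd hi.integrableOn hlim,
    Real.smoothTransition.zero_of_nonpos (by norm_num), sub_zero]

theorem norm_smoothTransition_le (x : ℝ) : ‖Real.smoothTransition x‖ ≤ 1 := by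
  rw [Real.norm_of_nonneg (Real.smoothTransition.nonneg x)]
  exact Real.smoothTransition.le_one x

/-- If `F' = K` on `(0, ∞)` in the sense of distributions, then `l F̂(l) - F(0) = K̂(l)`. The weak
equation is tested with `e^{-l t}` cut off near `0` and near `∞`; the derivative of the cutoff near
`0` is an approximate identity and produces the initial value. -/
theorem laplace_of_weak_deriv {F K : ℝ → ℝ} (hF : Continuous F) (hK : Continuous K) {C D : ℝ}
    (hC : ∀ t, |F t| ≤ C) (hD : ∀ t, |K t| ≤ D)
    (hw : ∀ η : ℝ → ℝ, ContDiff ℝ ∞ η → HasCompactSupport η → tsupport η ⊆ Ioi 0 →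
      ∫ t in Ioi (0 : ℝ), -(deriv η t * F t) = ∫ t in Ioi (0 : ℝ), η t * K t)
    {l : ℝ} (hl : 0 < l) : l * laplace F l - F 0 = laplace K l := by
  set S := Real.smoothTransition with hS
  have hSc : Continuous S := Real.smoothTransition.continuous
  have hS'c : Continuous (deriv S) := continuous_deriv_smoothTransition
  obtain ⟨B, hB⟩ := hasCompactSupport_deriv_smoothTransition.exists_bound_of_continuous hS'c
  set e : ℝ → ℝ := fun t => Real.exp (-(l * t)) with he
  have hec : Continuous e := by fun_prop
  have hei : IntegrableOn e (Ioi 0) := integrableOn_exp_neg_mul hl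
  have he0 : ∀ t, 0 ≤ e t := fun t => (Real.exp_pos _).le
  let N : ℕ → ℝ := fun n => n + 1
  have hN : ∀ n, 1 ≤ N n := fun n => by simp [N]
  have hNlim : Tendsto N atTop atTop :=
    tendsto_atTop_add_const_right _ _ tendsto_natCast_atTop_atTop
  -- The cutoffs near `0` and near infinity.
  let P : ℕ → ℝ → ℝ := fun n t => S (N n * t - 1)
  let Q : ℕ → ℝ → ℝ := fun n t => S (N n + 1 - t)
  have hP1 : ∀ n t, ‖P n t‖ ≤ 1 := fun n t => norm_smoothTransition_le _
  have hQ1 : ∀ n t, ‖Q n t‖ ≤ 1 := fun n t => norm_smoothTransition_le _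
  have hPc : ∀ n, Continuous (P n) := fun n => by fun_prop
  have hQc : ∀ n, Continuous (Q n) := fun n => by fun_prop
  have hPlim : ∀ t, 0 < t → ∀ᶠ n in atTop, P n t = 1 := fun t ht => by
    filter_upwards [(hNlim.atTop_mul_const ht).eventually_ge_atTop 2] with n hn
    exact Real.smoothTransition.one_of_one_le (by linarith)
  have hQlim : ∀ t, ∀ᶠ n in atTop, Q n t = 1 := fun t => by
    filter_upwards [hNlim.eventually_ge_atTop t] with n hn
    exact Real.smoothTransition.one_of_one_le (by linarith)
  have hQ'lim : ∀ t, ∀ᶠ n in atTop, deriv S (N n + 1 - t) = 0 := fun t => by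
    filter_upwards [hNlim.eventually_gt_atTop t] with n hn
    exact deriv_smoothTransition_eq_zero (Or.inr (by linarith))
  have hdη : ∀ n t, deriv (fun t => e t * P n t * Q n t) t = -l * (e t * P n t * Q n t) +
      N n * (e t * deriv S (N n * t - 1) * Q n t) - e t * P n t * deriv S (N n + 1 - t) := by
    intro n t
    have h1 : HasDerivAt e (e t * (-(l * 1))) t := ((hasDerivAt_id t).const_mul l).neg.exp
    have h2 : HasDerivAt (P n) (deriv S (N n * t - 1) * (N n * 1)) t :=
      (hasDerivAt_smoothTransition _).comp t (((hasDerivAt_id t).const_mul (N n)).sub_const 1)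
    have h3 : HasDerivAt (Q n) (deriv S (N n + 1 - t) * (-1)) t :=
      (hasDerivAt_smoothTransition _).comp t ((hasDerivAt_id t).const_sub (N n + 1))
    refine ((h1.mul h2).mul h3).deriv.trans ?_
    simp only [Pi.mul_apply]
    ring
  have hkey : ∀ n, ∫ t in Ioi (0 : ℝ), -(deriv (fun t => e t * P n t * Q n t) t * F t) =
      ∫ t in Ioi (0 : ℝ), (e t * P n t * Q n t) * K t := by
    intro n
    have hN0 : 0 < N n := zero_lt_one.trans_le (hN n)
    have hsupp : ∀ t, t ∉ Icc (N n)⁻¹ (N n + 1) → e t * P n t * Q n t = 0 := by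
      intro t ht
      rcases lt_or_ge t (N n)⁻¹ with h | h
      · have : N n * t ≤ 1 := by
          rw [← mul_inv_cancel₀ hN0.ne']
          exact mul_le_mul_of_nonneg_left h.le hN0.le
        have : P n t = 0 := Real.smoothTransition.zero_of_nonpos (by linarith)
        rw [this]; ring
      · have : N n + 1 < t := by
          by_contra! h2
          exact ht ⟨h, h2⟩
        have : Q n t = 0 := Real.smoothTransition.zero_of_nonpos (by linarith)
        rw [this]; ring
    have hts : tsupport (fun t => e t * P n t * Q n t) ⊆ Icc (N n)⁻¹ (N n + 1) :=
      closure_minimal (fun t ht => by_contra fun h => ht (hsupp t h)) isClosed_Icc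
    refine hw _ ?_ (.intro isCompact_Icc hsupp) (hts.trans fun t ht => ?_)
    · have h1 : ContDiff ℝ ∞ S := Real.smoothTransition.contDiff
      have h2 : ContDiff ℝ ∞ (P n) := h1.comp (by fun_prop)
      have h3 : ContDiff ℝ ∞ (Q n) := h1.comp (by fun_prop)
      have h4 : ContDiff ℝ ∞ e := by fun_prop
      exact (h4.mul h2).mul h3
    · exact (inv_pos.2 hN0).trans_le ht.1
  -- Away from the approximate identity, a multiple of `e` serves as majorant.
  have hbound : ∀ {u x y z X Y Z : ℝ}, ‖x‖ ≤ X → ‖y‖ ≤ Y → ‖z‖ ≤ Z → 0 ≤ u →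
      ‖u * x * y * z‖ ≤ X * Y * Z * u := by
    intro u x y z X Y Z hx hy hz hu
    rw [norm_mul, norm_mul, norm_mul, Real.norm_of_nonneg hu]
    have := (norm_nonneg x).trans hx
    have := (norm_nonneg y).trans hy
    calc u * ‖x‖ * ‖y‖ * ‖z‖ ≤ u * X * Y * Z := by gcongr
      _ = _ := by ring
  have hi1 : ∀ (G : ℝ → ℝ) (R : ℝ), Continuous G → (∀ t, |G t| ≤ R) →
      ∀ n, IntegrableOn (fun t => e t * P n t * Q n t * G t) (Ioi 0) := by
    intro G R hG hR n
    refine Integrable.mono' (Integrable.const_mul hei (1 * 1 * R))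
      (by fun_prop : Continuous _).aestronglyMeasurable (ae_of_all _ fun t => ?_)
    exact hbound (hP1 n t) (hQ1 n t) (hR t) (he0 t)
  have hlim1 : ∀ (G : ℝ → ℝ) (R : ℝ), Continuous G → (∀ t, |G t| ≤ R) →
      Tendsto (fun n => ∫ t in Ioi (0 : ℝ), e t * P n t * Q n t * G t) atTop
        (𝓝 (laplace G l)) := by
    intro G R hG hR
    refine tendsto_integral_of_dominated_convergence (fun t => 1 * 1 * R * e t)
      (fun n => (by fun_prop : Continuous _).aestronglyMeasurable) (Integrable.const_mul hei _)
      (fun n => ae_of_all _ fun t =>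
        hbound (hP1 n t) (hQ1 n t) (hR t) (he0 t)) ?_
    refine (ae_restrict_iff' measurableSet_Ioi).2 (ae_of_all _ fun t ht => ?_)
    refine tendsto_const_nhds.congr' ?_
    filter_upwards [hPlim t ht, hQlim t] with n h1 h2
    rw [h1, h2, mul_one, mul_one]
  have hi2 : ∀ n, IntegrableOn (fun t => e t * P n t * deriv S (N n + 1 - t) * F t) (Ioi 0) := by
    intro n
    refine Integrable.mono' (Integrable.const_mul hei (1 * B * C))
      (by fun_prop : Continuous _).aestronglyMeasurable (ae_of_all _ fun t => ?_)
    exact hbound (hP1 n t) (hB _) (hC t) (he0 t)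
  have hlim2 : Tendsto (fun n => ∫ t in Ioi (0 : ℝ), e t * P n t * deriv S (N n + 1 - t) * F t)
      atTop (𝓝 0) := by
    rw [show 𝓝 (0 : ℝ) = 𝓝 (∫ _ in Ioi (0 : ℝ), (0 : ℝ)) by rw [integral_zero]]
    refine tendsto_integral_of_dominated_convergence (fun t => 1 * B * C * e t)
      (fun n => (by fun_prop : Continuous _).aestronglyMeasurable) (Integrable.const_mul hei _)
      (fun n => ae_of_all _ fun t =>
        hbound (hP1 n t) (hB _) (hC t) (he0 t)) (ae_of_all _ fun t => ?_)
    refine tendsto_const_nhds.congr' ?_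
    filter_upwards [hQ'lim t] with n h1
    rw [h1, mul_zero, zero_mul]
  have hi3 : ∀ n, IntegrableOn (fun t => e t * deriv S (N n * t - 1) * Q n t * F t) (Ioi 0) := by
    intro n
    refine Integrable.mono' (Integrable.const_mul hei (B * 1 * C))
      (by fun_prop : Continuous _).aestronglyMeasurable (ae_of_all _ fun t => ?_)
    exact hbound (hB _) (hQ1 n t) (hC t) (he0 t)
  have hlim3 : Tendsto
      (fun n => N n * ∫ t in Ioi (0 : ℝ), e t * deriv S (N n * t - 1) * Q n t * F t)
      atTop (𝓝 (F 0)) := by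
    -- Rescaling by `N n` exhibits the approximate identity.
    have hsub : ∀ n, N n * ∫ t in Ioi (0 : ℝ), e t * deriv S (N n * t - 1) * Q n t * F t =
        ∫ s in Ioi (0 : ℝ), deriv S (s - 1) *
          (e ((N n)⁻¹ * s) * Q n ((N n)⁻¹ * s) * F ((N n)⁻¹ * s)) := by
      intro n
      have hN0 : 0 < N n := zero_lt_one.trans_le (hN n)
      have := integral_comp_mul_left_Ioi (fun s => deriv S (s - 1) *
          (e ((N n)⁻¹ * s) * Q n ((N n)⁻¹ * s) * F ((N n)⁻¹ * s))) 0 hN0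
      rw [mul_zero, smul_eq_mul, eq_inv_mul_iff_mul_eq₀ hN0.ne'] at this
      rw [← this]
      congr 2 with t
      rw [inv_mul_cancel_left₀ hN0.ne']
      ring
    simp_rw [hsub]
    have hone : F 0 = ∫ s in Ioi (0 : ℝ), deriv S (s - 1) * F 0 := by
      rw [integral_mul_const, integral_deriv_smoothTransition, one_mul]
    rw [hone]
    have hi : Integrable (fun s : ℝ => deriv S (s - 1)) :=
      (hS'c.integrable_of_hasCompactSupport
        hasCompactSupport_deriv_smoothTransition).comp_sub_right 1
    refine tendsto_integral_of_dominated_convergence (fun s => |deriv S (s - 1)| * (1 * 1 * C))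
      (fun n => (by fun_prop : Continuous _).aestronglyMeasurable)
      (hi.abs.integrableOn.mul_const _) (fun n => ?_) ?_
    · refine (ae_restrict_iff' measurableSet_Ioi).2 (ae_of_all _ fun s (hs : 0 < s) => ?_)
      have h1 : ‖e ((N n)⁻¹ * s)‖ ≤ 1 := by
        rw [Real.norm_of_nonneg (he0 _)]
        have : 0 < (N n)⁻¹ := inv_pos.2 (zero_lt_one.trans_le (hN n))
        exact Real.exp_le_one_iff.2 (neg_nonpos.2 (by positivity))
      rw [norm_mul, norm_mul, norm_mul]
      have h2 := hQ1 n ((N n)⁻¹ * s)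
      have h3 : ‖F ((N n)⁻¹ * s)‖ ≤ C := hC _
      exact mul_le_mul_of_nonneg_left (by gcongr) (abs_nonneg _)
    · refine ae_of_all _ fun s => Tendsto.const_mul _ ?_
      have h0 : Tendsto (fun n => (N n)⁻¹ * s) atTop (𝓝 0) := by
        simpa using (tendsto_inv_atTop_zero.comp hNlim).mul_const s
      have h1 : Tendsto (fun n => e ((N n)⁻¹ * s)) atTop (𝓝 1) := by
        have := (hec.tendsto 0).comp h0
        rwa [show e 0 = 1 by simp [he]] at this
      have h2 : Tendsto (fun n => Q n ((N n)⁻¹ * s)) atTop (𝓝 1) := by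
        refine tendsto_const_nhds.congr' ?_
        filter_upwards [h0.eventually_le_const zero_lt_one] with n hn
        exact (Real.smoothTransition.one_of_one_le (by linarith [hN n])).symm
      simpa using (h1.mul h2).mul ((hF.tendsto 0).comp h0)
  have heq : ∀ n, l * (∫ t in Ioi (0 : ℝ), e t * P n t * Q n t * F t) -
      (N n * ∫ t in Ioi (0 : ℝ), e t * deriv S (N n * t - 1) * Q n t * F t) +
      (∫ t in Ioi (0 : ℝ), e t * P n t * deriv S (N n + 1 - t) * F t) =
      ∫ t in Ioi (0 : ℝ), e t * P n t * Q n t * K t := by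
    intro n
    rw [← hkey n, ← integral_const_mul, ← integral_const_mul, ← integral_sub, ← integral_add]
    · congr 1 with t
      rw [hdη]
      ring
    · exact Integrable.sub (Integrable.const_mul (hi1 F C hF hC n) _)
        (Integrable.const_mul (hi3 n) _)
    · exact hi2 n
    · exact Integrable.const_mul (hi1 F C hF hC n) _
    · exact Integrable.const_mul (hi3 n) _
  have hL := (((hlim1 F C hF hC).const_mul l).sub hlim3).add hlim2
  simp_rw [heq, add_zero] at hL
  exact tendsto_nhds_unique hL (hlim1 K D hK hD)

/-! ### The equation after the Laplace transform in time -/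

theorem integrable_bdd_mul {u g : ℝ → ℝ} (hu : Continuous u) {M : ℝ} (hM : ∀ y, |u y| ≤ M)
    (hg : Integrable g) : Integrable (fun y => u y * g y) :=
  hg.bdd_mul hu.aestronglyMeasurable (ae_of_all _ hM)

section Pairing

variable {V : ℝ → ℝ → ℝ} {M : ℝ}

theorem continuous_integral_mul (hV : Continuous fun p : ℝ × ℝ => V p.1 p.2)
    (hM : ∀ y t, |V y t| ≤ M) {g : ℝ → ℝ} (hg : Integrable g) :
    Continuous fun t => ∫ y, V y t * g y := by
  refine continuous_of_dominated (bound := fun y => M * |g y|)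
    (fun t => (integrable_bdd_mul (u := fun y => V y t) (by fun_prop) (fun y => hM y t)
      hg).aestronglyMeasurable)
    (fun t => ae_of_all _ fun y => ?_) (hg.abs.const_mul M) (ae_of_all _ fun y => by fun_prop)
  rw [norm_mul]
  exact mul_le_mul_of_nonneg_right (hM y t) (abs_nonneg _)

theorem abs_integral_mul_le (hM : ∀ y t, |V y t| ≤ M) {g : ℝ → ℝ} (hg : Integrable g) (t : ℝ) :
    |∫ y, V y t * g y| ≤ M * ∫ y, |g y| := by
  rw [← integral_const_mul, ← Real.norm_eq_abs]
  refine norm_integral_le_of_norm_le (hg.abs.const_mul M) (ae_of_all _ fun y => ?_)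
  rw [norm_mul]
  exact mul_le_mul_of_nonneg_right (hM y t) (abs_nonneg _)

theorem continuous_laplace (hV : Continuous fun p : ℝ × ℝ => V p.1 p.2)
    (hM : ∀ y t, |V y t| ≤ M) {l : ℝ} (hl : 0 < l) : Continuous fun y => laplace (V y) l := by
  refine continuous_of_dominated (bound := fun t => Real.exp (-(l * t)) * M)
    (fun y => (by fun_prop : Continuous _).aestronglyMeasurable)
    (fun y => ae_of_all _ fun t => ?_) (Integrable.mul_const (integrableOn_exp_neg_mul hl) M)
    (ae_of_all _ fun t => by fun_prop)
  rw [norm_mul, Real.norm_of_nonneg (Real.exp_pos _).le]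
  exact mul_le_mul_of_nonneg_left (hM y t) (Real.exp_pos _).le

theorem abs_laplace_le (hM : ∀ y t, |V y t| ≤ M) {l : ℝ} (hl : 0 < l) (y : ℝ) :
    |laplace (V y) l| ≤ M / l := by
  rw [← laplace_const hl M, ← Real.norm_eq_abs]
  refine norm_integral_le_of_norm_le (laplaceConv_const hl M) (ae_of_all _ fun t => ?_)
  rw [norm_mul, Real.norm_of_nonneg (Real.exp_pos _).le]
  exact mul_le_mul_of_nonneg_left (hM y t) (Real.exp_pos _).le

theorem laplace_integral_mul (hV : Continuous fun p : ℝ × ℝ => V p.1 p.2)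
    (hM : ∀ y t, |V y t| ≤ M) {g : ℝ → ℝ} (hg : Integrable g) {l : ℝ} (hl : 0 < l) :
    laplace (fun t => ∫ y, V y t * g y) l = ∫ y, laplace (V y) l * g y := by
  have hint : Integrable (Function.uncurry fun t y => Real.exp (-(l * t)) * (V y t * g y))
      ((volume.restrict (Ioi 0)).prod volume) := by
    have h1 := Integrable.mul_prod (integrableOn_exp_neg_mul hl) hg
    refine (Integrable.bdd_mul (c := M) (f := fun p : ℝ × ℝ => V p.2 p.1) h1
      ?_ (ae_of_all _ fun p => hM p.2 p.1)).congr (ae_of_all _ fun p => ?_)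
    · exact (hV.comp continuous_swap).aestronglyMeasurable
    · simp only [Function.uncurry]
      ring
  have := integral_integral_swap hint
  simp only [laplace, ← integral_const_mul, ← integral_mul_const]
  rw [this]
  simp only [mul_assoc]

end Pairing

/-- A bounded solution may be taken to be constant in time for `t ≤ 0`, which makes it continuous
and bounded on the whole plane. -/
theorem IsBoundedSolution.extend {a b : ℝ} {V₀ : ℝ → ℝ} {V : ℝ → ℝ → ℝ}
    (h : IsBoundedSolution 1 a b V₀ V) :
    Continuous (fun p : ℝ × ℝ => V p.1 (max p.2 0)) ∧
    (∃ M, ∀ y t, |V y (max t 0)| ≤ M) ∧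
    IsBoundedSolution 1 a b V₀ (fun y t => V y (max t 0)) := by
  obtain ⟨M, hM⟩ := h.bounded
  have hc : Continuous (fun p : ℝ × ℝ => V p.1 (max p.2 0)) :=
    h.continuousOn.comp_continuous (f := fun p : ℝ × ℝ => (p.1, max p.2 0)) (by fun_prop)
      fun p => ⟨mem_univ _, mem_Ici.2 (le_max_right p.2 0)⟩
  have hM' : ∀ y t, |V y (max t 0)| ≤ M := fun y t => hM y _ (le_max_right _ _)
  refine ⟨hc, ⟨M, hM'⟩, hc.continuousOn, ⟨M, fun y t _ => hM' y t⟩, fun y => ?_, fun φ hφ => ?_⟩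
  · rw [max_self]; exact h.initial y
  · have e := h.equation φ hφ
    have hmax : ∀ t ∈ Ioi (0 : ℝ), max t 0 = t := fun t ht => max_eq_left (le_of_lt ht)
    refine Eq.trans (setIntegral_congr_fun measurableSet_Ioi fun t ht => ?_) (e.trans ?_)
    · simp only [hmax t ht]
    · congr 1
      · exact setIntegral_congr_fun measurableSet_Ioi fun t ht => by simp only [hmax t ht]
      · congr 1
        exact setIntegral_congr_fun measurableSet_Ioi fun t ht => by simp only [hmax t ht]

/-- The Laplace transform `v = V̂(·, l)` satisfies
`l v - V₀ = v'' - a² (v - 1 / l) - 2 b δ v` in the sense of distributions on the line. -/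
theorem IsBoundedSolution.laplace_equation {a b : ℝ} {V₀ : ℝ → ℝ} {V : ℝ → ℝ → ℝ}
    (h : IsBoundedSolution 1 a b V₀ V) (hV : Continuous fun p : ℝ × ℝ => V p.1 p.2) {M : ℝ}
    (hM : ∀ y t, |V y t| ≤ M) {l : ℝ} (hl : 0 < l) {χ : ℝ → ℝ} (hχ : ContDiff ℝ ∞ χ)
    (hχc : HasCompactSupport χ) :
    l * (∫ y, laplace (V y) l * χ y) - (∫ y, V₀ y * χ y) =
      (∫ y, laplace (V y) l * deriv (deriv χ) y) - a ^ 2 * (∫ y, laplace (V y) l * χ y) +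
        a ^ 2 / l * (∫ y, χ y) - 2 * b * χ 0 * laplace (V 0) l := by
  have hχ2 : Continuous (deriv (deriv χ)) :=
    (contDiff_infty_iff_deriv.1 (contDiff_infty_iff_deriv.1 hχ).2).2.continuous
  have hi0 : Integrable χ := hχ.continuous.integrable_of_hasCompactSupport hχc
  have hi2 : Integrable (deriv (deriv χ)) :=
    hχ2.integrable_of_hasCompactSupport hχc.deriv.deriv
  set g : ℝ → ℝ := fun y => deriv (deriv χ) y - a ^ 2 * χ y with hg
  have hgi : Integrable g := hi2.sub (hi0.const_mul _)
  set I := ∫ y, χ y with hI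
  set F : ℝ → ℝ := fun t => ∫ y, V y t * χ y with hF
  set G : ℝ → ℝ := fun t => ∫ y, V y t * g y with hG
  have hFc : Continuous F := continuous_integral_mul hV hM hi0
  have hGc : Continuous G := continuous_integral_mul hV hM hgi
  have hGb : ∀ t, |G t| ≤ M * ∫ y, |g y| := abs_integral_mul_le hM hgi
  have hV0c : Continuous (V 0) := hV.comp (f := fun t => ((0 : ℝ), t)) (by fun_prop)
  have hw : ∀ η : ℝ → ℝ, ContDiff ℝ ∞ η → HasCompactSupport η → tsupport η ⊆ Ioi 0 →
      ∫ t in Ioi (0 : ℝ), -(deriv η t * F t) =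
        ∫ t in Ioi (0 : ℝ), η t * (G t + a ^ 2 * I - 2 * b * χ 0 * V 0 t) := by
    intro η hη hηc hηs
    have hsub : tsupport (fun p : ℝ × ℝ => η p.2 * χ p.1) ⊆ tsupport χ ×ˢ tsupport η := by
      refine closure_minimal (fun p hp => ?_) ((isClosed_tsupport χ).prod (isClosed_tsupport η))
      exact ⟨subset_tsupport _ (right_ne_zero_of_mul hp),
        subset_tsupport _ (left_ne_zero_of_mul hp)⟩
    have htest : IsTestFunction (fun p : ℝ × ℝ => η p.2 * χ p.1) :=
      ⟨(hη.comp contDiff_snd).mul (hχ.comp contDiff_fst),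
        (hχc.isCompact.prod hηc.isCompact).of_isClosed_subset (isClosed_tsupport _) hsub,
        fun p hp => hηs (hsub hp).2⟩
    have e := h.equation _ htest
    have hd1 : ∀ y t, deriv (fun s => η s * χ y) t = deriv η t * χ y := fun y t =>
      deriv_mul_const_field _
    have hd2 : ∀ y t, iteratedDeriv 2 (fun z => η t * χ z) y = η t * deriv (deriv χ) y := by
      intro y t
      rw [iteratedDeriv_succ, iteratedDeriv_one,
        show deriv (fun z => η t * χ z) = fun z => η t * deriv χ z from
          funext fun z => deriv_const_mul_field _]
      exact deriv_const_mul_field _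
    simp only [hd1, hd2] at e
    have eL : ∀ t, ∫ y, -(1 * (V y t * (deriv η t * χ y))) = -(deriv η t * F t) := fun t => by
      rw [integral_neg, hF, ← integral_const_mul]
      congr 2 with y
      ring
    have eR : ∀ t, ∫ y, (V y t * (η t * deriv (deriv χ) y) - a ^ 2 * (V y t - 1) * (η t * χ y)) =
        η t * (G t + a ^ 2 * I) := fun t => by
      rw [hG, hI, ← integral_const_mul, ← integral_add
        (integrable_bdd_mul (u := fun y => V y t) (by fun_prop) (fun y => hM y t) hgi)
        (hi0.const_mul _), ← integral_const_mul]
      congr 1 with y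
      rw [hg]
      ring
    simp only [eL, eR] at e
    have hcη : ∀ p : ℝ → ℝ, Continuous p → IntegrableOn (fun t => η t * p t) (Ioi 0) :=
      fun p hp => ((hη.continuous.mul hp).integrable_of_hasCompactSupport
        hηc.mul_right).integrableOn
    have e2 : 2 * b * ∫ t in Ioi (0 : ℝ), V 0 t * (η t * χ 0) =
        ∫ t in Ioi (0 : ℝ), η t * (2 * b * χ 0 * V 0 t) := by
      rw [← integral_const_mul]
      congr 1 with t
      ring
    rw [e, e2, ← integral_sub (hcη (fun t => G t + a ^ 2 * I) (by fun_prop))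
      (hcη (fun t => 2 * b * χ 0 * V 0 t) (by fun_prop))]
    simp only [mul_sub]
  have hV0b : ∀ t, |G t + a ^ 2 * I - 2 * b * χ 0 * V 0 t| ≤
      M * (∫ y, |g y|) + |a ^ 2 * I| + |2 * b * χ 0| * M := by
    intro t
    refine (abs_sub _ _).trans (add_le_add ((abs_add_le _ _).trans
      (add_le_add (hGb t) le_rfl)) ?_)
    rw [abs_mul]
    exact mul_le_mul_of_nonneg_left (hM 0 t) (abs_nonneg _)
  have key := laplace_of_weak_deriv hFc (by fun_prop) (abs_integral_mul_le hM hi0) hV0b hw hl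
  have hGl : LaplaceConv G l := .of_bounded hGc hGb hl
  have hV0l : LaplaceConv (V 0) l := .of_bounded hV0c (hM 0) hl
  rw [laplace_sub (hGl.add (laplaceConv_const hl (a ^ 2 * I))) (hV0l.const_mul _),
    laplace_add hGl (laplaceConv_const hl _), laplace_const hl, laplace_const_mul, hF, hG,
    laplace_integral_mul hV hM hi0 hl, laplace_integral_mul hV hM hgi hl] at key
  simp only [h.initial] at key
  have hv := continuous_laplace hV hM hl
  have hvb := abs_laplace_le (V := V) hM hl
  have e3 : ∫ y, laplace (V y) l * g y = (∫ y, laplace (V y) l * deriv (deriv χ) y) -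
      a ^ 2 * ∫ y, laplace (V y) l * χ y := by
    rw [← integral_const_mul, ← integral_sub (integrable_bdd_mul hv hvb hi2)
      ((integrable_bdd_mul hv hvb hi0).const_mul _)]
    congr 1 with y
    rw [hg]
    ring
  rw [key, e3]
  ring

/-! ### Test functions that decay at infinity -/

/-- A smooth integrable function with integrable first and second derivatives is a limit of test
functions, together with its second derivative, when integrated against bounded functions. -/
theorem exists_testFunction_approx {ψ : ℝ → ℝ} (hψ : ContDiff ℝ ∞ ψ) (h0 : Integrable ψ)
    (h1 : Integrable (deriv ψ)) (h2 : Integrable (deriv (deriv ψ))) :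
    ∃ χ : ℕ → ℝ → ℝ, (∀ n, ContDiff ℝ ∞ (χ n)) ∧ (∀ n, HasCompactSupport (χ n)) ∧
      (∀ n, χ n 0 = ψ 0) ∧ ∀ (u : ℝ → ℝ) (M : ℝ), Continuous u → (∀ y, |u y| ≤ M) →
        Tendsto (fun n => ∫ y, u y * χ n y) atTop (𝓝 (∫ y, u y * ψ y)) ∧
        Tendsto (fun n => ∫ y, u y * deriv (deriv (χ n)) y) atTop
          (𝓝 (∫ y, u y * deriv (deriv ψ) y)) := by
  let κ : ContDiffBump (0 : ℝ) := ⟨1, 2, by norm_num, by norm_num⟩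
  have hκ : ContDiff ℝ ∞ κ := κ.contDiff
  have hκd : ∀ f : ℝ → ℝ, ContDiff ℝ ∞ f → ContDiff ℝ ∞ (deriv f) := fun f hf =>
    (contDiff_infty_iff_deriv.1 hf).2
  have hder : ∀ f : ℝ → ℝ, ContDiff ℝ ∞ f → ∀ x, HasDerivAt f (deriv f x) x := fun f hf x =>
    (hf.differentiable (by simp) x).hasDerivAt
  have hκ1 := hκd κ hκ
  have hκ2 := hκd _ hκ1
  have hψ1 := hκd ψ hψ
  have hψ2 := hκd _ hψ1
  obtain ⟨B0, hB0⟩ := κ.hasCompactSupport.exists_bound_of_continuous hκ.continuous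
  obtain ⟨B1, hB1⟩ := κ.hasCompactSupport.deriv.exists_bound_of_continuous hκ1.continuous
  obtain ⟨B2, hB2⟩ := κ.hasCompactSupport.deriv.deriv.exists_bound_of_continuous hκ2.continuous
  let ε : ℕ → ℝ := fun n => 1 / (n + 1)
  have hε0 : ∀ n, 0 < ε n := fun n => Nat.one_div_pos_of_nat
  have hε1 : ∀ n, ε n ≤ 1 := fun n => by
    simp only [ε]
    rw [div_le_one (by positivity)]
    linarith [n.cast_nonneg (α := ℝ)]
  have hεlim : Tendsto ε atTop (𝓝 0) := tendsto_one_div_add_atTop_nhds_zero_nat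
  have hεy : ∀ y, Tendsto (fun n => ε n * y) atTop (𝓝 0) := fun y => by
    simpa using hεlim.mul_const y
  have hsc : ∀ n, ∀ f : ℝ → ℝ, ContDiff ℝ ∞ f → ∀ y,
      HasDerivAt (fun y => f (ε n * y)) (ε n * deriv f (ε n * y)) y := fun n f hf y =>
    ((hder f hf _).comp y ((hasDerivAt_id y).const_mul (ε n))).congr_deriv (by
      rw [id_eq]; ring)
  have hd1 : ∀ n y, HasDerivAt (fun y => κ (ε n * y) * ψ y)
      (ε n * deriv κ (ε n * y) * ψ y + κ (ε n * y) * deriv ψ y) y := fun n y =>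
    (hsc n κ hκ y).mul (hder ψ hψ y)
  have hd2 : ∀ n y, deriv (deriv fun y => κ (ε n * y) * ψ y) y =
      ε n ^ 2 * deriv (deriv κ) (ε n * y) * ψ y + 2 * ε n * deriv κ (ε n * y) * deriv ψ y +
        κ (ε n * y) * deriv (deriv ψ) y := fun n y => by
    rw [show deriv (fun y => κ (ε n * y) * ψ y) = _ from funext fun y => (hd1 n y).deriv]
    refine HasDerivAt.deriv ((((((hsc n _ hκ1 y).const_mul (ε n)).mul (hder ψ hψ y)).add
      ((hsc n κ hκ y).mul (hder _ hψ1 y)))).congr_deriv ?_)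
    ring
  refine ⟨fun n y => κ (ε n * y) * ψ y, fun n => ?_, fun n => ?_, fun n => ?_,
    fun u M hu hM => ?_⟩
  · exact (hκ.comp (by fun_prop)).mul hψ
  · exact (κ.hasCompactSupport.comp_homeomorph
      (Homeomorph.mulLeft₀ (ε n) (hε0 n).ne')).mul_right
  · simp only [mul_zero]
    rw [κ.one_of_mem_closedBall (Metric.mem_closedBall_self κ.rIn_pos.le), one_mul]
  · have hM0 := (abs_nonneg _).trans (hM 0)
    have hκlim : ∀ y, Tendsto (fun n => κ (ε n * y)) atTop (𝓝 1) := fun y => by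
      have := (hκ.continuous.tendsto 0).comp (hεy y)
      rwa [κ.one_of_mem_closedBall (Metric.mem_closedBall_self κ.rIn_pos.le)] at this
    have hcκ : ∀ n, Continuous fun y => κ (ε n * y) := fun n => hκ.continuous.comp (by fun_prop)
    have hcκ1 : ∀ n, Continuous fun y => deriv κ (ε n * y) := fun n =>
      hκ1.continuous.comp (by fun_prop)
    have hcκ2 : ∀ n, Continuous fun y => deriv (deriv κ) (ε n * y) := fun n =>
      hκ2.continuous.comp (by fun_prop)
    have hcψ := hψ.continuous
    have hcψ1 := hψ1.continuous
    have hcψ2 := hψ2.continuous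
    constructor
    · refine tendsto_integral_of_dominated_convergence (fun y => M * (B0 * |ψ y|))
        (fun n => ?_) ((h0.abs.const_mul _).const_mul _) (fun n => ae_of_all _ fun y => ?_)
        (ae_of_all _ fun y => ?_)
      · exact (hu.mul ((hcκ n).mul hcψ)).aestronglyMeasurable
      · rw [norm_mul, norm_mul]
        have := hM y
        have := hB0 (ε n * y)
        simp only [Real.norm_eq_abs] at *
        gcongr
      · simpa using ((hκlim y).mul_const (ψ y)).const_mul (u y)
    · simp_rw [hd2]
      refine tendsto_integral_of_dominated_convergence
        (fun y => M * (B2 * |ψ y| + 2 * B1 * |deriv ψ y| + B0 * |deriv (deriv ψ) y|))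
        (fun n => ?_) ((((h0.abs.const_mul _).add (h1.abs.const_mul _)).add
          (h2.abs.const_mul _)).const_mul _) (fun n => ae_of_all _ fun y => ?_)
        (ae_of_all _ fun y => ?_)
      · exact (hu.mul ((((continuous_const.mul (hcκ2 n)).mul hcψ).add
          ((continuous_const.mul (hcκ1 n)).mul hcψ1)).add
            ((hcκ n).mul hcψ2))).aestronglyMeasurable
      · rw [norm_mul]
        have e0 : |κ (ε n * y)| ≤ B0 := hB0 (ε n * y)
        have e1 : |deriv κ (ε n * y)| ≤ B1 := hB1 (ε n * y)
        have e2 : |deriv (deriv κ) (ε n * y)| ≤ B2 := hB2 (ε n * y)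
        have hε2 : ε n ^ 2 ≤ 1 := pow_le_one₀ (hε0 n).le (hε1 n)
        refine mul_le_mul (hM y) ?_ (norm_nonneg _) hM0
        refine (norm_add₃_le).trans (add_le_add (add_le_add ?_ ?_) ?_) <;>
          simp only [Real.norm_eq_abs, abs_mul]
        · rw [abs_of_nonneg (sq_nonneg (ε n))]
          have : ε n ^ 2 * |deriv (deriv κ) (ε n * y)| ≤ 1 * B2 := by gcongr
          rw [one_mul] at this
          gcongr
        · rw [abs_of_pos (hε0 n), abs_of_pos two_pos]
          have : 2 * ε n * |deriv κ (ε n * y)| ≤ 2 * 1 * B1 := by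
            gcongr
            exact hε1 n
          rw [mul_one] at this
          gcongr
        · gcongr
      · have hk1 : Tendsto (fun n => deriv κ (ε n * y)) atTop (𝓝 (deriv κ 0)) :=
          (hκ1.continuous.tendsto 0).comp (hεy y)
        have hk2 : Tendsto (fun n => deriv (deriv κ) (ε n * y)) atTop (𝓝 (deriv (deriv κ) 0)) :=
          (hκ2.continuous.tendsto 0).comp (hεy y)
        have := ((((hεlim.pow 2).mul hk2).mul_const (ψ y)).add
          (((hεlim.const_mul 2).mul hk1).mul_const (deriv ψ y))).add
          ((hκlim y).mul_const (deriv (deriv ψ) y))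
        simpa using this.const_mul (u y)

theorem IsBoundedSolution.laplace_equation_of_integrable {a b : ℝ} {V₀ : ℝ → ℝ} {V : ℝ → ℝ → ℝ}
    (h : IsBoundedSolution 1 a b V₀ V) (hV : Continuous fun p : ℝ × ℝ => V p.1 p.2) {M : ℝ}
    (hM : ∀ y t, |V y t| ≤ M) {l : ℝ} (hl : 0 < l) {ψ : ℝ → ℝ} (hψ : ContDiff ℝ ∞ ψ)
    (h0 : Integrable ψ) (h1 : Integrable (deriv ψ)) (h2 : Integrable (deriv (deriv ψ))) :
    l * (∫ y, laplace (V y) l * ψ y) - (∫ y, V₀ y * ψ y) =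
      (∫ y, laplace (V y) l * deriv (deriv ψ) y) - a ^ 2 * (∫ y, laplace (V y) l * ψ y) +
        a ^ 2 / l * (∫ y, ψ y) - 2 * b * ψ 0 * laplace (V 0) l := by
  obtain ⟨χ, hχ, hχc, hχ0, hlim⟩ := exists_testFunction_approx hψ h0 h1 h2
  obtain ⟨l1, l2⟩ := hlim _ _ (continuous_laplace hV hM hl) (abs_laplace_le (V := V) hM hl)
  have hV0 : V₀ = fun y => V y 0 := funext fun y => (h.initial y).symm
  have l3 := (hlim V₀ M (by rw [hV0]; fun_prop) (fun y => by rw [hV0]; exact hM y 0)).1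
  have l4 := (hlim (fun _ => 1) 1 continuous_const (fun y => by simp)).1
  simp only [one_mul] at l4
  have e := fun n => h.laplace_equation hV hM hl (hχ n) (hχc n)
  simp only [hχ0] at e
  exact tendsto_nhds_unique (((l1.const_mul l).sub l3).congr e)
    (((l2.sub (l1.const_mul _)).add (l4.const_mul _)).sub_const _)

/-! ### The Laplace transform of the trace -/

theorem integral_exp_neg_mul_abs {m : ℝ} (hm : 0 < m) :
    ∫ y : ℝ, Real.exp (-(m * |y|)) = 2 / m := by
  have h := laplace_const hm 1
  simp only [laplace, mul_one] at h
  rw [integral_comp_abs (f := fun y => Real.exp (-(m * y))), h, mul_one_div]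

theorem integrable_exp_neg_mul_abs {m : ℝ} (hm : 0 < m) :
    Integrable fun y : ℝ => Real.exp (-(m * |y|)) := by
  by_contra hn
  have := integral_exp_neg_mul_abs hm
  rw [integral_undef hn] at this
  exact (div_pos two_pos hm).ne this

theorem one_le_sqrt_one_add_sq (z : ℝ) : 1 ≤ √(1 + z ^ 2) :=
  Real.one_le_sqrt.2 (by nlinarith [sq_nonneg z])

theorem hasDerivAt_sqrt_one_add_sq (z : ℝ) :
    HasDerivAt (fun z : ℝ => √(1 + z ^ 2)) (z / √(1 + z ^ 2)) z := by
  have h := ((hasDerivAt_pow 2 z).const_add 1).sqrt (by positivity)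
  refine h.congr_deriv ?_
  have := one_le_sqrt_one_add_sq z
  field_simp
  norm_num

theorem hasDerivAt_div_sqrt_one_add_sq (z : ℝ) :
    HasDerivAt (fun z : ℝ => z / √(1 + z ^ 2)) (1 / √(1 + z ^ 2) ^ 3) z := by
  have h1 := one_le_sqrt_one_add_sq z
  have h2 : √(1 + z ^ 2) ^ 2 = 1 + z ^ 2 := Real.sq_sqrt (by positivity)
  refine ((hasDerivAt_id z).div (hasDerivAt_sqrt_one_add_sq z) (by positivity)).congr_deriv ?_
  simp only [id_eq]
  field_simp
  rw [h2]
  ring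

theorem integrable_one_div_sqrt_one_add_sq_cube :
    Integrable fun z : ℝ => 1 / √(1 + z ^ 2) ^ 3 := by
  refine integrable_inv_one_add_sq.mono' ?_ (ae_of_all _ fun z => ?_)
  · exact Continuous.aestronglyMeasurable (by
      fun_prop (disch := intro z; have := one_le_sqrt_one_add_sq z; positivity))
  · have h1 := one_le_sqrt_one_add_sq z
    have h2 : √(1 + z ^ 2) ^ 2 = 1 + z ^ 2 := Real.sq_sqrt (by positivity)
    rw [Real.norm_of_nonneg (by positivity), one_div]
    exact inv_anti₀ (by positivity) (h2.symm.le.trans (pow_le_pow_right₀ h1 (by norm_num)))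

theorem integral_one_div_sqrt_one_add_sq_cube : ∫ z : ℝ, 1 / √(1 + z ^ 2) ^ 3 = 2 := by
  have e : (fun z : ℝ => z / √(1 + z ^ 2)) = fun z => Real.sin (Real.arctan z) :=
    funext fun z => (Real.sin_arctan z).symm
  have hs := Real.continuous_sin
  have hbot : Tendsto (fun z : ℝ => z / √(1 + z ^ 2)) atBot (𝓝 (-1)) := by
    have := (hs.tendsto (-(Real.pi / 2))).comp
      (Real.tendsto_arctan_atBot.mono_right nhdsWithin_le_nhds)
    rw [Real.sin_neg, Real.sin_pi_div_two] at this
    rw [e]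
    exact this
  have htop : Tendsto (fun z : ℝ => z / √(1 + z ^ 2)) atTop (𝓝 1) := by
    have := (hs.tendsto (Real.pi / 2)).comp
      (Real.tendsto_arctan_atTop.mono_right nhdsWithin_le_nhds)
    rw [Real.sin_pi_div_two] at this
    rw [e]
    exact this
  rw [integral_of_hasDerivAt_of_tendsto hasDerivAt_div_sqrt_one_add_sq
    integrable_one_div_sqrt_one_add_sq_cube hbot htop]
  norm_num

/-- A smooth approximation of `e^{-m |y|}` as `N → ∞`. -/
noncomputable def smoothExpAbs (m N y : ℝ) : ℝ := Real.exp (-(m / N * √(1 + (N * y) ^ 2)))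

section SmoothExpAbs

variable {m N : ℝ}

theorem contDiff_smoothExpAbs : ContDiff ℝ ∞ (smoothExpAbs m N) := by
  refine ContDiff.exp (ContDiff.neg (contDiff_const.mul (ContDiff.sqrt (by fun_prop) ?_)))
  intro y
  positivity

theorem smoothExpAbs_pos (y : ℝ) : 0 < smoothExpAbs m N y := Real.exp_pos _

theorem hasDerivAt_smoothExpAbs (hN : 0 < N) (y : ℝ) : HasDerivAt (smoothExpAbs m N)
    (-m * (N * y / √(1 + (N * y) ^ 2)) * smoothExpAbs m N y) y := by
  have h1 := (hasDerivAt_sqrt_one_add_sq (N * y)).comp y ((hasDerivAt_id y).const_mul N)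
  refine ((h1.const_mul (m / N)).neg.exp).congr_deriv ?_
  change smoothExpAbs m N y * -(m / N * (N * y / √(1 + (N * y) ^ 2) * (N * 1))) = _
  field_simp

/-- `ψ'' - m² ψ` is minus an approximation of `2 m δ`, as it should be for `ψ ≈ e^{-m |y|}`. -/
theorem deriv_deriv_smoothExpAbs (hN : 0 < N) (y : ℝ) :
    deriv (deriv (smoothExpAbs m N)) y = m ^ 2 * smoothExpAbs m N y -
      (m ^ 2 / √(1 + (N * y) ^ 2) ^ 2 + m * N / √(1 + (N * y) ^ 2) ^ 3) * smoothExpAbs m N y := by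
  rw [show deriv (smoothExpAbs m N) = _ from
    funext fun y => (hasDerivAt_smoothExpAbs (m := m) hN y).deriv]
  have h1 := ((hasDerivAt_div_sqrt_one_add_sq (N * y)).comp y
    ((hasDerivAt_id y).const_mul N)).const_mul (-m)
  refine (HasDerivAt.deriv (h1.mul (hasDerivAt_smoothExpAbs (m := m) hN y))).trans ?_
  simp only [Function.comp_apply]
  have h2 := one_le_sqrt_one_add_sq (N * y)
  have h3 : √(1 + (N * y) ^ 2) ^ 2 = 1 + (N * y) ^ 2 := Real.sq_sqrt (by positivity)
  have h4 : (N * y) ^ 2 = √(1 + (N * y) ^ 2) ^ 2 - 1 := by rw [h3]; ring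
  set E := √(1 + (N * y) ^ 2)
  have hE : E ≠ 0 := by positivity
  field_simp
  linear_combination (m ^ 2 * smoothExpAbs m N y * E) * h4

theorem smoothExpAbs_le (hm : 0 ≤ m) (hN : 0 < N) (y : ℝ) :
    smoothExpAbs m N y ≤ Real.exp (-(m * |y|)) := by
  refine Real.exp_le_exp.2 (neg_le_neg ?_)
  have h1 : N * |y| ≤ √(1 + (N * y) ^ 2) := by
    refine Real.le_sqrt_of_sq_le ?_
    rw [mul_pow, mul_pow, sq_abs]
    linarith
  calc m * |y| = m / N * (N * |y|) := by field_simp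
    _ ≤ _ := by gcongr

theorem integrable_smoothExpAbs (hm : 0 < m) (hN : 0 < N) : Integrable (smoothExpAbs m N) := by
  refine (integrable_exp_neg_mul_abs hm).mono'
    contDiff_smoothExpAbs.continuous.aestronglyMeasurable (ae_of_all _ fun y => ?_)
  rw [Real.norm_of_nonneg (smoothExpAbs_pos y).le]
  exact smoothExpAbs_le hm.le hN y

theorem integrable_deriv_smoothExpAbs (hm : 0 < m) (hN : 0 < N) :
    Integrable (deriv (smoothExpAbs m N)) := by
  refine ((integrable_smoothExpAbs hm hN).const_mul m).mono'
    (contDiff_infty_iff_deriv.1 contDiff_smoothExpAbs).2.continuous.aestronglyMeasurable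
    (ae_of_all _ fun y => ?_)
  rw [(hasDerivAt_smoothExpAbs hN y).deriv, ← Real.sin_arctan, norm_mul, norm_mul, norm_neg,
    Real.norm_of_nonneg hm.le, Real.norm_of_nonneg (smoothExpAbs_pos y).le]
  refine mul_le_mul_of_nonneg_right ?_ (smoothExpAbs_pos y).le
  exact mul_le_of_le_one_right hm.le (Real.abs_sin_le_one _)

theorem integrable_deriv_deriv_smoothExpAbs (hm : 0 < m) (hN : 0 < N) :
    Integrable (deriv (deriv (smoothExpAbs m N))) := by
  refine ((integrable_smoothExpAbs hm hN).const_mul (m ^ 2 + (m ^ 2 + m * N))).mono'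
    (contDiff_infty_iff_deriv.1
      (contDiff_infty_iff_deriv.1 contDiff_smoothExpAbs).2).2.continuous.aestronglyMeasurable
    (ae_of_all _ fun y => ?_)
  have hp := smoothExpAbs_pos (m := m) (N := N) y
  have hE := one_le_sqrt_one_add_sq (N * y)
  rw [deriv_deriv_smoothExpAbs hN y, add_mul (m ^ 2)]
  refine (norm_sub_le _ _).trans (add_le_add (Real.norm_of_nonneg (by positivity)).le ?_)
  rw [Real.norm_of_nonneg (by positivity)]
  gcongr
  · exact div_le_self (by positivity) (one_le_pow₀ hE)
  · exact div_le_self (by positivity) (one_le_pow₀ hE)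

end SmoothExpAbs

/-- Testing the transformed equation with `e^{-μ |y|}`, `μ = √(l + a²)`, which is the decaying
solution of `μ² ψ - ψ'' = 2 μ δ`, removes all values of `V̂(·, l)` except the one at `y = 0`. -/
theorem IsBoundedSolution.laplace_trace {a b : ℝ} {V₀ : ℝ → ℝ} {V : ℝ → ℝ → ℝ}
    (h : IsBoundedSolution 1 a b V₀ V) (hV : Continuous fun p : ℝ × ℝ => V p.1 p.2) {M : ℝ}
    (hM : ∀ y t, |V y t| ≤ M) {l : ℝ} (hl : 0 < l) :
    2 * (√(l + a ^ 2) + b) * laplace (V 0) l =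
      (∫ y, V₀ y * Real.exp (-(√(l + a ^ 2) * |y|))) + a ^ 2 / l * (2 / √(l + a ^ 2)) := by
  set m := √(l + a ^ 2) with hm_def
  have hm : 0 < m := Real.sqrt_pos.2 (by positivity)
  have hm2 : m ^ 2 = l + a ^ 2 := Real.sq_sqrt (by positivity)
  set v : ℝ → ℝ := fun y => laplace (V y) l with hv_def
  have hv : Continuous v := continuous_laplace hV hM hl
  have hvb : ∀ y, |v y| ≤ M / l := abs_laplace_le hM hl
  have hV0 : V₀ = fun y => V y 0 := funext fun y => (h.initial y).symm
  have hV0c : Continuous V₀ := by rw [hV0]; fun_prop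
  have hV0b : ∀ y, |V₀ y| ≤ M := fun y => by rw [hV0]; exact hM y 0
  let N : ℕ → ℝ := fun n => n + 1
  have hN1 : ∀ n, 1 ≤ N n := fun n => by simp [N]
  have hN : ∀ n, 0 < N n := fun n => zero_lt_one.trans_le (hN1 n)
  have hNlim : Tendsto N atTop atTop :=
    tendsto_atTop_add_const_right _ _ tendsto_natCast_atTop_atTop
  have hNinv : Tendsto (fun n => (N n)⁻¹) atTop (𝓝 0) := tendsto_inv_atTop_zero.comp hNlim
  have hE : ∀ z : ℝ, 1 ≤ √(1 + z ^ 2) := one_le_sqrt_one_add_sq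
  have hEc : Continuous fun z : ℝ => √(1 + z ^ 2) := by fun_prop
  have hψlim : ∀ y, Tendsto (fun n => smoothExpAbs m (N n) y) atTop
      (𝓝 (Real.exp (-(m * |y|)))) := by
    intro y
    have e : ∀ n, smoothExpAbs m (N n) y = Real.exp (-(m * √((N n)⁻¹ ^ 2 + y ^ 2))) := by
      intro n
      have : √(1 + (N n * y) ^ 2) = N n * √((N n)⁻¹ ^ 2 + y ^ 2) := by
        rw [← Real.sqrt_sq (hN n).le, ← Real.sqrt_mul (sq_nonneg _), Real.sqrt_sq (hN n).le]
        congr 1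
        have := (hN n).ne'
        field_simp
      rw [smoothExpAbs, this]
      congr 2
      have := (hN n).ne'
      field_simp
    simp_rw [e]
    refine (Real.continuous_exp.tendsto _).comp (Tendsto.neg (Tendsto.const_mul m ?_))
    rw [← Real.sqrt_sq_eq_abs]
    refine (Real.continuous_sqrt.tendsto _).comp ?_
    simpa using (hNinv.pow 2).add_const (y ^ 2)
  have hlim : ∀ (u : ℝ → ℝ) (R : ℝ), Continuous u → (∀ y, |u y| ≤ R) →
      Tendsto (fun n => ∫ y, u y * smoothExpAbs m (N n) y) atTop
        (𝓝 (∫ y, u y * Real.exp (-(m * |y|)))) := by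
    intro u R hu hR
    have hR0 := (abs_nonneg _).trans (hR 0)
    refine tendsto_integral_of_dominated_convergence (fun y => R * Real.exp (-(m * |y|)))
      (fun n => (hu.mul contDiff_smoothExpAbs.continuous).aestronglyMeasurable)
      ((integrable_exp_neg_mul_abs hm).const_mul R) (fun n => ae_of_all _ fun y => ?_)
      (ae_of_all _ fun y => (hψlim y).const_mul (u y))
    rw [norm_mul, Real.norm_of_nonneg (smoothExpAbs_pos y).le]
    exact mul_le_mul (hR y) (smoothExpAbs_le hm.le (hN n) y) (smoothExpAbs_pos y).le hR0
  -- The error term `m² ψ - ψ''`, which is concentrated at the origin.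
  let r : ℕ → ℝ → ℝ := fun n y => (m ^ 2 / √(1 + (N n * y) ^ 2) ^ 2 +
    m * N n / √(1 + (N n * y) ^ 2) ^ 3) * smoothExpAbs m (N n) y
  have hr : Tendsto (fun n => ∫ y, v y * r n y) atTop (𝓝 (2 * m * v 0)) := by
    let q : ℕ → ℝ → ℝ := fun n z => v ((N n)⁻¹ * z) * ((m ^ 2 * (N n)⁻¹ / √(1 + z ^ 2) ^ 2 +
      m * (1 / √(1 + z ^ 2) ^ 3)) * Real.exp (-(m * (N n)⁻¹ * √(1 + z ^ 2))))
    -- The substitution `z = N n * y`.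
    have hq : ∀ n, ∫ y, v y * r n y = ∫ z, q n z := by
      intro n
      have hn := (hN n).ne'
      have e := Measure.integral_comp_mul_left (fun z => N n * q n z) (N n)
      rw [integral_const_mul (N n) (q n), smul_eq_mul, abs_of_pos (inv_pos.2 (hN n)),
        inv_mul_cancel_left₀ hn] at e
      rw [← e]
      congr 1 with y
      simp only [q, r, smoothExpAbs, inv_mul_cancel_left₀ hn, div_eq_mul_inv m (N n)]
      have := hE (N n * y)
      field_simp
    simp_rw [hq]
    have hconst : 2 * m * v 0 = ∫ z : ℝ, v 0 * (m * (1 / √(1 + z ^ 2) ^ 3)) := by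
      rw [integral_const_mul, integral_const_mul, integral_one_div_sqrt_one_add_sq_cube]
      ring
    rw [hconst]
    have hE0 : ∀ z : ℝ, √(1 + z ^ 2) ^ 2 ≠ 0 := fun z => by have := hE z; positivity
    have hE0' : ∀ z : ℝ, √(1 + z ^ 2) ^ 3 ≠ 0 := fun z => by have := hE z; positivity
    refine tendsto_integral_of_dominated_convergence
      (fun z => M / l * ((m ^ 2 + m) * (1 + z ^ 2)⁻¹)) (fun n => ?_)
      ((integrable_inv_one_add_sq.const_mul _).const_mul _) (fun n => ae_of_all _ fun z => ?_)
      (ae_of_all _ fun z => ?_)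
    · exact Continuous.aestronglyMeasurable (by fun_prop (disch := assumption))
    · have h1 := hE z
      have hM0 : 0 ≤ M / l := (abs_nonneg _).trans (hvb 0)
      have hNi := inv_pos.2 (hN n)
      have hNi1 : (N n)⁻¹ ≤ 1 := inv_le_one_of_one_le₀ (hN1 n)
      rw [norm_mul]
      refine mul_le_mul (hvb _) ?_ (norm_nonneg _) hM0
      rw [Real.norm_of_nonneg (by positivity)]
      have h2 : √(1 + z ^ 2) ^ 2 = 1 + z ^ 2 := Real.sq_sqrt (by positivity)
      have h3 : Real.exp (-(m * (N n)⁻¹ * √(1 + z ^ 2))) ≤ 1 :=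
        Real.exp_le_one_iff.2 (neg_nonpos.2 (by positivity))
      refine (mul_le_of_le_one_right (by positivity) h3).trans ?_
      have h5 : (1 + z ^ 2)⁻¹ = 1 / √(1 + z ^ 2) ^ 2 := by rw [h2, one_div]
      rw [h5, add_mul, mul_one_div (m ^ 2)]
      have h4 : √(1 + z ^ 2) ^ 2 ≤ √(1 + z ^ 2) ^ 3 := pow_le_pow_right₀ h1 (by norm_num)
      gcongr
      exact mul_le_of_le_one_right (by positivity) hNi1
    · have l0 : Tendsto (fun n => (N n)⁻¹ * z) atTop (𝓝 0) := by simpa using hNinv.mul_const z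
      have l1 : Tendsto (fun n => v ((N n)⁻¹ * z)) atTop (𝓝 (v 0)) := (hv.tendsto 0).comp l0
      have l2 := (((hNinv.const_mul (m ^ 2)).div_const (√(1 + z ^ 2) ^ 2)).add_const
        (m * (1 / √(1 + z ^ 2) ^ 3)))
      have l3 := (Real.continuous_exp.tendsto _).comp
        (((hNinv.const_mul m).mul_const (√(1 + z ^ 2))).neg)
      have := l1.mul (l2.mul l3)
      simpa [q] using this
  have heq : ∀ n, (∫ y, v y * r n y) = (∫ y, V₀ y * smoothExpAbs m (N n) y) +
      a ^ 2 / l * (∫ y, 1 * smoothExpAbs m (N n) y) - 2 * b * smoothExpAbs m (N n) 0 * v 0 := by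
    intro n
    have hi := integrable_smoothExpAbs hm (hN n)
    have hi2 := integrable_deriv_deriv_smoothExpAbs hm (hN n)
    have e := h.laplace_equation_of_integrable hV hM hl (contDiff_smoothExpAbs (m := m) (N := N n))
      hi (integrable_deriv_smoothExpAbs hm (hN n)) hi2
    have e2 : ∫ y, v y * r n y = m ^ 2 * (∫ y, v y * smoothExpAbs m (N n) y) -
        ∫ y, v y * deriv (deriv (smoothExpAbs m (N n))) y := by
      rw [← integral_const_mul, ← integral_sub ((integrable_bdd_mul hv hvb hi).const_mul _)
        (integrable_bdd_mul hv hvb hi2)]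
      congr 1 with y
      rw [deriv_deriv_smoothExpAbs (hN n)]
      ring
    rw [e2, hm2]
    simp only [one_mul]
    linear_combination e
  have L := ((hlim V₀ M hV0c hV0b).add ((hlim (fun _ => 1) 1 continuous_const
    (by simp)).const_mul (a ^ 2 / l))).sub (((hψlim 0).const_mul (2 * b)).mul_const (v 0))
  have e := tendsto_nhds_unique hr (L.congr fun n => (heq n).symm)
  simp only [one_mul, integral_exp_neg_mul_abs hm, abs_zero, mul_zero, neg_zero, Real.exp_zero,
    mul_one] at e
  linear_combination e

/-- For the initial data of the theorem, the trace is the function of `trace_of_laplace_eq` with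
`ξ₀ = 1 - c` and `A = a c - b (1 - c)`. -/
theorem IsBoundedSolution.laplace_trace_explicit {a b c : ℝ} (ha : 0 ≤ a) (hb : 0 < b)
    {V : ℝ → ℝ → ℝ} (h : IsBoundedSolution 1 a b (fun y => 1 - c * Real.exp (-a * |y|)) V)
    (hV : Continuous fun p : ℝ × ℝ => V p.1 p.2) {M : ℝ} (hM : ∀ y t, |V y t| ≤ M) {l : ℝ}
    (hl : 0 < l) : laplace (V 0) l =
      (1 - c) / l + (a * c - b * (1 - c)) / (l * (√(l + a ^ 2) + b)) := by
  have e := h.laplace_trace hV hM hl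
  set m := √(l + a ^ 2) with hm_def
  have hm : 0 < m := Real.sqrt_pos.2 (by positivity)
  have hm2 : m ^ 2 = l + a ^ 2 := Real.sq_sqrt (by positivity)
  have hma : 0 < m + a := by positivity
  have hV0 : ∫ y : ℝ, (1 - c * Real.exp (-a * |y|)) * Real.exp (-(m * |y|)) =
      2 / m - c * (2 / (m + a)) := by
    rw [← integral_exp_neg_mul_abs hm, ← integral_exp_neg_mul_abs hma, ← integral_const_mul,
      ← integral_sub (integrable_exp_neg_mul_abs hm) ((integrable_exp_neg_mul_abs hma).const_mul c)]
    congr 1 with y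
    rw [show -((m + a) * |y|) = -a * |y| + -(m * |y|) by ring, Real.exp_add]
    ring
  rw [hV0] at e
  have hmb : 0 < m + b := by positivity
  have hdiff : 1 / (m + a) = (m - a) / l := by
    rw [div_eq_div_iff hma.ne' hl.ne']
    linear_combination -hm2
  have hsum : 2 / m + a ^ 2 / l * (2 / m) = 2 * m / l := by
    field_simp
    linear_combination -hm2
  have e2 : laplace (V 0) l = (m / l - c * ((m - a) / l)) / (m + b) := by
    rw [eq_div_iff hmb.ne', ← hdiff]
    linear_combination e / 2 + hsum / 2
  rw [e2]
  field_simp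
  ring

end KWC

theorem lemma1p2 (a b : ℝ) (ha : 0 ≤ a) (hb : 0 < b) :
    (∀ (c : ℝ) (V : ℝ → ℝ → ℝ),
      KWC.IsBoundedSolution 1 a b (fun y => 1 - c * Real.exp (-a * |y|)) V →
      ∀ ξ : ℝ → ℝ, ξ = (fun t => V 0 t) →
        ∀ t : ℝ, 0 < t →
          DifferentiableAt ℝ ξ t ∧
          IntervalIntegrable (deriv ξ) volume 0 t ∧
          IntervalIntegrable (fun s => KWC.memoryKernel a (t - s) * deriv ξ s) volume 0 t ∧
          ∫ s in (0 : ℝ)..t, KWC.memoryKernel a (t - s) * deriv ξ s =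
            -gradient (KWC.limitEnergy a b) (ξ t)) ∧
    (∀ t : ℝ, 0 < t →
      DifferentiableAt ℝ (KWC.memoryKernel a) t ∧ deriv (KWC.memoryKernel a) t < 0) ∧
    (∀ t : ℝ, 0 < t → 0 < KWC.memoryKernel a t) ∧
    Tendsto (KWC.memoryKernel a) atTop (𝓝 0) := by
  refine ⟨fun c V h ξ hξ t ht => ?_, fun t ht => ⟨(KWC.hasDerivAt_memoryKernel a
    ht).differentiableAt, KWC.deriv_memoryKernel_neg a ht⟩, fun t ht => KWC.memoryKernel_pos ha ht,
    KWC.tendsto_memoryKernel ha⟩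
  obtain ⟨hc, ⟨M, hM⟩, hW⟩ := h.extend
  set A := a * c - b * (1 - c) with hA_def
  set p := KWC.traceDeriv a b A with hp_def
  have hp : KWC.AbelType p := KWC.abelType_traceDeriv a b A
  have hk := KWC.abelType_abelInverse a
  have hWc : Continuous fun t => V 0 (max t 0) := hc.comp (f := fun t => ((0 : ℝ), t)) (by fun_prop)
  have htrace : ∀ s, 0 < s → HasDerivAt ξ (p s) s ∧
      KWC.halfConv p (fun _ => 1) s = ξ s - (1 - c) ∧
      KWC.halfConv p (KWC.abelInverse a) s = A - b * (ξ s - (1 - c)) := by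
    intro s hs
    have := KWC.trace_of_laplace_eq hb hWc.continuousOn
      (fun l hl => KWC.LaplaceConv.of_bounded hWc (hM 0) hl)
      (fun l hl => hW.laplace_trace_explicit ha hb hc hM hl) hs
    have heq : ∀ r ∈ Ioi (0 : ℝ), V 0 (max r 0) = ξ r := fun r hr => by
      rw [hξ, max_eq_left (le_of_lt hr)]
    rw [heq s hs] at this
    refine ⟨this.1.congr_of_eventuallyEq ?_, this.2⟩
    filter_upwards [Ioi_mem_nhds hs] with r hr using (heq r hr).symm
  have hderiv : ∀ s ∈ uIoc 0 t, p s = deriv ξ s := fun s hs => by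
    rw [uIoc_of_le ht.le] at hs
    exact (htrace s hs.1).1.deriv.symm
  have hi1 := hp.halfConv_integrable (KWC.abelType_const 1) ht
  have hik := hp.halfConv_integrable hk ht
  have hm : ∀ s ∈ uIoc 0 t, 2 * (p s * KWC.abelInverse a (t - s)) - 2 * a * (p s * 1) =
      KWC.memoryKernel a (t - s) * deriv ξ s := fun s hs => by
    rw [← hderiv s hs, KWC.memoryKernel_eq]
    ring
  obtain ⟨hd, h1, h2⟩ := htrace t ht
  refine ⟨hd.differentiableAt, (hp.intervalIntegrable ht.le).congr hderiv,
    ((hik.const_mul 2).sub (hi1.const_mul (2 * a))).congr hm, ?_⟩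
  have hgrad : HasDerivAt (KWC.limitEnergy a b) (2 * b * ξ t + 2 * a * (ξ t - 1)) (ξ t) := by
    have := ((hasDerivAt_pow 2 (ξ t)).const_mul b).add
      ((((hasDerivAt_id (ξ t)).sub_const 1).pow 2).const_mul a)
    refine this.congr_deriv ?_
    simp only [id_eq]
    ring
  have hint : ∫ s in (0 : ℝ)..t, KWC.memoryKernel a (t - s) * deriv ξ s =
      2 * KWC.halfConv p (KWC.abelInverse a) t - 2 * a * KWC.halfConv p (fun _ => 1) t := by
    rw [KWC.halfConv, KWC.halfConv, ← intervalIntegral.integral_const_mul,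
      ← intervalIntegral.integral_const_mul,
      ← intervalIntegral.integral_sub (hik.const_mul 2) (hi1.const_mul (2 * a))]
    exact intervalIntegral.integral_congr_ae (ae_of_all _ fun s hs => (hm s hs).symm)
  rw [gradient_eq_deriv', hgrad.deriv, hint, h1, h2, hA_def]
  ring
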